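/- All C*-algebras are complex. A C*-algebra is *simple* if it is nonzero and has no norm-closed two-sided ideals other than $0$ and itself. A projection $p$ in a C*-algebra $A$ is *infinite* if there is $v\in A$ such that $v^*v=p$ and $vv^*$ is a projection with $vv^*\le p$ and $vv^*\neq p$. A simple C*-algebra is *purely infinite* if each of its nonzero hereditary C*-subalgebras contains an infinite projection. For a unital C*-algebra $A$, $K_0(A)$ denotes the Grothendieck group of the abelian monoid of Murray-von Neumann equivalence classes of projections in $\bigcup_{n} M_n(A)$ (where $p\in M_n(A)$ and $q\in M_m(A)$ are equivalent if $p=v^*v$ and $q=vv^*$ for some $m\times n$ matrix $v$ over $A$), with addition induced by $(p,q)\mapsto \mathrm{diag}(p,q)$; $[1_A]\in K_0(A)$ is the class of the unit $1_A\in M_1(A)=A$, and $GL(A)$ is the group of invertible elements of $A$. **Theorem.** Let $A$ and $B$ be unital, simple, purely infinite C*-algebras. If $GL(A)$ and $GL(B)$ are isomorphic as abstract groups, then there is a group isomorphism $K_0(A)\to K_0(B)$ sending $[1_A]$ to $[1_B]$. -/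

import Mathlib

open scoped Matrix

namespace CStarK

universe u

/-! ### Simplicity and pure infiniteness -/

section Algebra

variable (A : Type u) [CStarAlgebra A]

/-- A C*-algebra is simple if it is nonzero and its only norm-closed two-sided ideals are
`0` and the whole algebra.  (In a unital algebra every ring ideal is a complex subspace.) -/
def IsSimple : Prop :=
  Nontrivial A ∧ ∀ I : TwoSidedIdeal A, IsClosed (I : Set A) → I = ⊥ ∨ I = ⊤

variable {A}

/-- `a` is a positive element of the C*-algebra `A`. -/
def IsPositive (a : A) : Prop := ∃ y : A, a = star y * y

/-- A hereditary C*-subalgebra: a norm-closed (not necessarily unital) *-subalgebra `H` such that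
`0 ≤ a ≤ b` and `b ∈ H` imply `a ∈ H`. -/
def IsHereditary (H : NonUnitalStarSubalgebra ℂ A) : Prop :=
  IsClosed (H : Set A) ∧ ∀ a b : A, b ∈ H → IsPositive a → IsPositive (b - a) → a ∈ H

/-- A projection `p` is infinite if it is Murray-von Neumann equivalent to a proper
subprojection `q` of itself: `v* v = p`, `v v* = q`, `q ≤ p` (that is, `p q = q`), `q ≠ p`.
If `p` lies in a hereditary subalgebra, then so does any such `v`, because `v = p v p`. -/
def IsInfiniteProjection (p : A) : Prop :=
  IsStarProjection p ∧ ∃ q : A, IsStarProjection q ∧ p * q = q ∧ q ≠ p ∧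
    ∃ v : A, star v * v = p ∧ v * star v = q

variable (A)

/-- Pure infiniteness of a simple C*-algebra: every nonzero hereditary C*-subalgebra
contains an infinite projection. -/
def IsPurelyInfinite : Prop :=
  ∀ H : NonUnitalStarSubalgebra ℂ A, IsHereditary H → H ≠ ⊥ →
    ∃ p ∈ H, IsInfiniteProjection p

end Algebra

/-! ### The group `K₀` of a unital C*-algebra -/

section KZero

variable {A : Type u} [CStarAlgebra A]

/-- Murray-von Neumann equivalence of two square matrices over `A`, possibly of different sizes,
implemented by a rectangular matrix `v`. -/
def MvN {ι κ : Type*} [Fintype ι] [Fintype κ] (p : Matrix ι ι A) (q : Matrix κ κ A) : Prop :=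
  ∃ v : Matrix κ ι A, vᴴ * v = p ∧ v * vᴴ = q

theorem MvN.symm {ι κ : Type*} [Fintype ι] [Fintype κ] {p : Matrix ι ι A} {q : Matrix κ κ A}
    (h : MvN p q) : MvN q p := by
  obtain ⟨v, h1, h2⟩ := h
  exact ⟨vᴴ, by simpa using h2, by simpa using h1⟩

theorem MvN.trans {ι κ μ : Type*} [Fintype ι] [Fintype κ] [Fintype μ] {p : Matrix ι ι A}
    {q : Matrix κ κ A} {r : Matrix μ μ A} (hp : p * p = p) (hr : r * r = r)
    (h : MvN p q) (h' : MvN q r) : MvN p r := by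
  obtain ⟨v, h1, h2⟩ := h
  obtain ⟨w, h3, h4⟩ := h'
  refine ⟨w * v, ?_, ?_⟩
  · calc (w * v)ᴴ * (w * v) = vᴴ * (wᴴ * w) * v := by
          simp only [Matrix.conjTranspose_mul, Matrix.mul_assoc]
      _ = (vᴴ * v) * (vᴴ * v) := by rw [h3, ← h2]; simp only [Matrix.mul_assoc]
      _ = p := by rw [h1, hp]
  · calc (w * v) * (w * v)ᴴ = w * (v * vᴴ) * wᴴ := by
          simp only [Matrix.conjTranspose_mul, Matrix.mul_assoc]
      _ = (w * wᴴ) * (w * wᴴ) := by rw [h2, ← h3]; simp only [Matrix.mul_assoc]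
      _ = r := by rw [h4, hr]

theorem MvN.of_reindex {ι κ : Type*} [Fintype ι] [Fintype κ] {p : Matrix ι ι A}
    (hp : IsStarProjection p) (e : ι ≃ κ) : MvN p (Matrix.reindex e e p) := by
  have hs : pᴴ = p := hp.isSelfAdjoint
  have hi : p * p = p := hp.isIdempotentElem
  refine ⟨p.submatrix e.symm id, ?_, ?_⟩
  · rw [Matrix.conjTranspose_submatrix, hs, Matrix.submatrix_mul_equiv, hi, Matrix.submatrix_id_id]
  · have := Matrix.submatrix_mul_equiv p p e.symm (Equiv.refl ι) e.symm
    rw [Matrix.conjTranspose_submatrix, hs, Matrix.reindex_apply]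
    simpa [hi] using this

/-- The block sum `diag(p, q)`, indexed by the disjoint union. -/
def blockSum {ι κ : Type*} (p : Matrix ι ι A) (q : Matrix κ κ A) : Matrix (ι ⊕ κ) (ι ⊕ κ) A :=
  Matrix.fromBlocks p 0 0 q

theorem MvN.blockSum {ι κ ι' κ' : Type*} [Fintype ι] [Fintype κ] [Fintype ι'] [Fintype κ']
    {p : Matrix ι ι A} {q : Matrix κ κ A} {p' : Matrix ι' ι' A} {q' : Matrix κ' κ' A}
    (h : MvN p p') (h' : MvN q q') : MvN (blockSum p q) (blockSum p' q') := by
  obtain ⟨v, h1, h2⟩ := h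
  obtain ⟨w, h3, h4⟩ := h'
  refine ⟨Matrix.fromBlocks v 0 0 w, ?_, ?_⟩ <;>
    simp [CStarK.blockSum, Matrix.fromBlocks_conjTranspose, Matrix.fromBlocks_multiply, h1, h2,
      h3, h4]

theorem isStarProjection_blockSum {ι κ : Type*} [Fintype ι] [Fintype κ]
    {p : Matrix ι ι A} {q : Matrix κ κ A} (hp : IsStarProjection p) (hq : IsStarProjection q) :
    IsStarProjection (blockSum p q) := by
  have hp1 : p * p = p := hp.isIdempotentElem
  have hq1 : q * q = q := hq.isIdempotentElem
  have hp2 : pᴴ = p := hp.isSelfAdjoint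
  have hq2 : qᴴ = q := hq.isSelfAdjoint
  rw [isStarProjection_iff']
  refine ⟨?_, ?_⟩
  · simp [blockSum, Matrix.fromBlocks_multiply, hp1, hq1]
  · simp [Matrix.star_eq_conjTranspose, blockSum, Matrix.fromBlocks_conjTranspose, hp2, hq2]

theorem isStarProjection_reindex {ι κ : Type*} [Fintype ι] [Fintype κ]
    {p : Matrix ι ι A} (hp : IsStarProjection p) (e : ι ≃ κ) :
    IsStarProjection (Matrix.reindex e e p) := by
  have hp1 : p * p = p := hp.isIdempotentElem
  have hp2 : pᴴ = p := hp.isSelfAdjoint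
  rw [isStarProjection_iff']
  refine ⟨?_, ?_⟩
  · rw [Matrix.reindex_apply, Matrix.submatrix_mul_equiv, hp1]
  · rw [Matrix.star_eq_conjTranspose, Matrix.reindex_apply, Matrix.conjTranspose_submatrix, hp2]

variable (A)

/-- A projection in some matrix algebra `M_n(A)`, with `n` arbitrary. -/
structure MatProj where
  /-- the size of the matrix -/
  size : ℕ
  /-- the matrix -/
  mat : Matrix (Fin size) (Fin size) A
  isProj : IsStarProjection mat

variable {A}

/-- The projection `p ⊕ q = diag(p, q)` in `M_{n+m}(A)`. -/
def MatProj.add (p q : MatProj A) : MatProj A where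
  size := p.size + q.size
  mat := Matrix.reindex finSumFinEquiv finSumFinEquiv (blockSum p.mat q.mat)
  isProj := isStarProjection_reindex (isStarProjection_blockSum p.isProj q.isProj) _

/-- The zero projection (of size zero). -/
def MatProj.zero : MatProj A where
  size := 0
  mat := 0
  isProj := IsStarProjection.zero _

/-- The unit of `A`, as a projection in `M_1(A)`. -/
def MatProj.one : MatProj A where
  size := 1
  mat := 1
  isProj := IsStarProjection.one _

theorem MatProj.idem (p : MatProj A) : p.mat * p.mat = p.mat := p.isProj.isIdempotentElem

theorem MatProj.mvN_refl (p : MatProj A) : MvN p.mat p.mat := by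
  have h : p.mat ᴴ = p.mat := p.isProj.isSelfAdjoint
  exact ⟨p.mat, by rw [h, p.idem], by rw [h, p.idem]⟩

variable (A)

/-- Murray-von Neumann equivalence on projections in matrix algebras over `A`. -/
def MatProj.setoid : Setoid (MatProj A) where
  r p q := MvN p.mat q.mat
  iseqv := ⟨fun p => p.mvN_refl, fun h => h.symm, fun {p _ r} h h' => h.trans p.idem r.idem h'⟩

/-- The semigroup of Murray-von Neumann classes of projections in matrix algebras over `A`. -/
def V : Type u := Quotient (MatProj.setoid A)

variable {A}

/-- The Murray-von Neumann class of a projection. -/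
def V.mk (p : MatProj A) : V A := Quotient.mk (MatProj.setoid A) p

theorem V.sound {p q : MatProj A} (h : MvN p.mat q.mat) : V.mk p = V.mk q :=
  Quotient.sound (s := MatProj.setoid A) h

theorem MatProj.mvN_add (p q : MatProj A) : MvN (blockSum p.mat q.mat) (p.add q).mat :=
  MvN.of_reindex (isStarProjection_blockSum p.isProj q.isProj) _

theorem MatProj.idem_blockSum (p q : MatProj A) :
    blockSum p.mat q.mat * blockSum p.mat q.mat = blockSum p.mat q.mat :=
  (isStarProjection_blockSum p.isProj q.isProj).isIdempotentElem

theorem MatProj.add_congr {p q p' q' : MatProj A} (h : MvN p.mat p'.mat) (h' : MvN q.mat q'.mat) :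
    MvN (p.add q).mat (p'.add q').mat :=
  ((p.mvN_add q).symm.trans (p.add q).idem (p'.idem_blockSum q') (h.blockSum h')).trans
    (p.add q).idem (p'.add q').idem (p'.mvN_add q')

theorem MatProj.add_comm_mvN (p q : MatProj A) : MvN (p.add q).mat (q.add p).mat := by
  have h := MvN.of_reindex (isStarProjection_blockSum p.isProj q.isProj) (Equiv.sumComm _ _)
  have e : Matrix.reindex (Equiv.sumComm _ _) (Equiv.sumComm _ _) (blockSum p.mat q.mat)
      = blockSum q.mat p.mat := by
    ext i j
    rcases i with i | i <;> rcases j with j | j <;> simp [blockSum]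
  rw [e] at h
  exact ((p.mvN_add q).symm.trans (p.add q).idem (q.idem_blockSum p) h).trans
    (p.add q).idem (q.add p).idem (q.mvN_add p)

theorem MatProj.zero_add_mvN (p : MatProj A) : MvN (MatProj.zero.add p).mat p.mat := by
  refine MvN.trans (MatProj.add _ _).idem p.idem (MatProj.mvN_add _ p).symm ?_
  have h := MvN.of_reindex p.isProj (Equiv.emptySum (Fin 0) (Fin p.size)).symm
  have e : Matrix.reindex (Equiv.emptySum (Fin 0) (Fin p.size)).symm
      (Equiv.emptySum (Fin 0) (Fin p.size)).symm p.mat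
      = blockSum (MatProj.zero (A := A)).mat p.mat := by
    ext i j
    rcases i with i | i
    · exact i.elim0
    · rcases j with j | j
      · exact j.elim0
      · simp only [Matrix.reindex_apply, Matrix.submatrix_apply, Equiv.symm_symm,
          Equiv.emptySum_apply_inr, blockSum]
        exact (Matrix.fromBlocks_apply₂₂ _ _ _ _ i j).symm
  rw [e] at h
  exact h.symm

theorem MatProj.add_assoc_mvN (p q r : MatProj A) :
    MvN ((p.add q).add r).mat (p.add (q.add r)).mat := by
  have h1 : MvN ((p.add q).add r).mat (blockSum (p.add q).mat r.mat) := (MatProj.mvN_add _ _).symm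
  have h2 : MvN (blockSum (p.add q).mat r.mat) (blockSum (blockSum p.mat q.mat) r.mat) :=
    (p.mvN_add q).symm.blockSum r.mvN_refl
  have hP := isStarProjection_blockSum (isStarProjection_blockSum p.isProj q.isProj) r.isProj
  have hQ := isStarProjection_blockSum p.isProj (isStarProjection_blockSum q.isProj r.isProj)
  have h3 := MvN.of_reindex hP (Equiv.sumAssoc _ _ _)
  have e : Matrix.reindex (Equiv.sumAssoc _ _ _) (Equiv.sumAssoc _ _ _)
      (blockSum (blockSum p.mat q.mat) r.mat) = blockSum p.mat (blockSum q.mat r.mat) := by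
    ext i j
    rcases i with i | i | i <;> rcases j with j | j | j <;> simp [blockSum]
  rw [e] at h3
  have h4 : MvN (blockSum p.mat (blockSum q.mat r.mat)) (blockSum p.mat (q.add r).mat) :=
    p.mvN_refl.blockSum (q.mvN_add r)
  have h5 := p.mvN_add (q.add r)
  have i0 := ((p.add q).add r).idem
  exact (((h1.trans i0 hP.isIdempotentElem h2).trans i0 hQ.isIdempotentElem h3).trans i0
    (p.idem_blockSum (q.add r)) h4).trans i0 (p.add (q.add r)).idem h5

instance : Zero (V A) := ⟨V.mk MatProj.zero⟩

/-- Addition of classes is the block sum of representatives. -/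
instance : Add (V A) :=
  ⟨Quotient.map₂ MatProj.add fun _ _ h _ _ h' => MatProj.add_congr h h'⟩

theorem V.mk_add (p q : MatProj A) : V.mk p + V.mk q = V.mk (p.add q) := rfl

theorem V.zero_add' (x : V A) : 0 + x = x :=
  Quotient.inductionOn x fun p => V.sound p.zero_add_mvN

theorem V.add_comm' (x y : V A) : x + y = y + x :=
  Quotient.inductionOn₂ x y fun p q => V.sound (p.add_comm_mvN q)

theorem V.add_assoc' (x y z : V A) : x + y + z = x + (y + z) :=
  Quotient.inductionOn₃ x y z fun p q r => V.sound (p.add_assoc_mvN q r)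

instance : AddCommMonoid (V A) where
  add_assoc := V.add_assoc'
  zero_add := V.zero_add'
  add_zero x := (V.add_comm' x 0).trans (V.zero_add' x)
  add_comm := V.add_comm'
  nsmul := nsmulRec

variable (A)

/-- `K₀(A)` for a unital C*-algebra `A`: the Grothendieck group of the abelian monoid of
Murray-von Neumann classes of projections in matrix algebras over `A`. -/
abbrev KZero : Type u := Algebra.GrothendieckAddGroup (V A)

/-- The class `[1_A]` in `K₀(A)`. -/
noncomputable def KZero.unitClass : KZero A :=
  Algebra.GrothendieckAddGroup.of (V.mk (MatProj.one (A := A)))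

end KZero

end CStarK

/-! Involutions in the unit group are exactly the units `1 - 2e` with `e` idempotent, so a group
isomorphism `φ` induces a bijection `idemMap` between idempotents. It respects conjugation,
commutation and the symmetric difference `e + f - 2ef` of commuting idempotents. It also respects
complements, because in a simple algebra `-1` is the only central involution other than `1`. None of
this directly detects orthogonality, which is what addition in `K₀` needs.

Orthogonality is recovered up to complements. For commuting `e`, `f` the idempotents commuting with
every unit that commutes with both include all sums of the four products of `e` or `1 - e` with `f`
or `1 - f`. If there are only the eight obvious ones, some product vanishes
(`BicentralizerSmall.mul_eq_zero`); if `e` and `f` are orthogonal, primeness leaves only those eight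
(`bicentralizerSmall_of_orthogonal`). The condition is group-theoretic, so it passes through `φ`.

The ambiguity is removed by Cuntz's description of `K₀` of a simple purely infinite algebra: every
class comes from an idempotent other than `0` and `1`, and two such idempotents with equal class are
conjugate; the same holds for orthogonal pairs with sum different from `1`. Hence the relation
between the images of an orthogonal pair depends only on the two classes. Replacing `idemMap e` by
its complement according to the class of `e` gives `signedMap`, which preserves orthogonality, sums
and complements (`signedMap_mul`, `signedMap_add`, `signedMap_one_sub`). It therefore induces a
homomorphism on `K₀`; complements make it unital, and bijectivity of `idemMap` makes it bijective.
-/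

namespace CStarK

universe u v

/-! ### Algebraic equivalence of idempotents in a ring -/

section Ring

variable {R : Type*} [Ring R]

/-- Algebraic (Murray-von Neumann) equivalence of elements of a ring. -/
def AlgEquivalent (e f : R) : Prop := ∃ x y : R, x * y = e ∧ y * x = f

theorem AlgEquivalent.symm {e f : R} (h : AlgEquivalent e f) : AlgEquivalent f e := by
  obtain ⟨x, y, h1, h2⟩ := h
  exact ⟨y, x, h2, h1⟩

theorem AlgEquivalent.refl {e : R} (he : IsIdempotentElem e) : AlgEquivalent e e :=
  ⟨e, e, he, he⟩

theorem AlgEquivalent.trans {e f g : R} (he : IsIdempotentElem e) (hg : IsIdempotentElem g)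
    (h : AlgEquivalent e f) (h' : AlgEquivalent f g) : AlgEquivalent e g := by
  obtain ⟨x, y, rfl, rfl⟩ := h
  obtain ⟨z, w, h3, rfl⟩ := h'
  refine ⟨x * z, w * y, ?_, ?_⟩
  · calc x * z * (w * y) = x * (z * w) * y := by simp only [mul_assoc]
      _ = (x * y) * (x * y) := by rw [h3]; simp only [mul_assoc]
      _ = x * y := he
  · calc w * y * (x * z) = w * (y * x) * z := by simp only [mul_assoc]
      _ = (w * z) * (w * z) := by rw [← h3]; simp only [mul_assoc]
      _ = w * z := hg

/-- An equivalence between idempotents may be implemented by elements of the corners. -/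
theorem AlgEquivalent.exists_corner {e f : R} (he : IsIdempotentElem e) (hf : IsIdempotentElem f)
    (h : AlgEquivalent e f) :
    ∃ x y : R, x * y = e ∧ y * x = f ∧ e * x = x ∧ x * f = x ∧ f * y = y ∧ y * e = y := by
  obtain ⟨x, y, h1, h2⟩ := h
  have hx : e * x = x * f := by rw [← h1, ← h2, mul_assoc]
  have hy : f * y = y * e := by rw [← h1, ← h2, mul_assoc]
  refine ⟨e * x, f * y, ?_, ?_, ?_, ?_, ?_, ?_⟩
  · rw [hy, mul_assoc, ← mul_assoc x, h1, he.eq, he.eq]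
  · rw [hx, mul_assoc, ← mul_assoc y, h2, hf.eq, hf.eq]
  · rw [← mul_assoc, he.eq]
  · rw [hx, mul_assoc, hf.eq]
  · rw [← mul_assoc, hf.eq]
  · rw [hy, mul_assoc, he.eq]

theorem AlgEquivalent.eq_zero_iff {e f : R} (he : IsIdempotentElem e) (hf : IsIdempotentElem f)
    (h : AlgEquivalent e f) : e = 0 ↔ f = 0 := by
  obtain ⟨x, y, h1, h2, h3, h4, h5, h6⟩ := h.exists_corner he hf
  constructor
  · rintro rfl; rw [← h2, ← h3]; simp
  · rintro rfl; rw [← h1, ← h5]; simp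

theorem isIdempotentElem_add {e f : R} (he : IsIdempotentElem e)
    (hf : IsIdempotentElem f) (hef : e * f = 0) (hfe : f * e = 0) : IsIdempotentElem (e + f) := by
  simp [IsIdempotentElem, mul_add, add_mul, he.eq, hf.eq, hef, hfe]

theorem AlgEquivalent.add {e f e' f' : R} (he : IsIdempotentElem e) (hf : IsIdempotentElem f)
    (he' : IsIdempotentElem e') (hf' : IsIdempotentElem f') (hef : e * f = 0) (hfe : f * e = 0)
    (hef' : e' * f' = 0) (hfe' : f' * e' = 0) (h : AlgEquivalent e e') (h' : AlgEquivalent f f') :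
    AlgEquivalent (e + f) (e' + f') := by
  obtain ⟨x, y, h1, h2, h3, h4, h5, h6⟩ := h.exists_corner he he'
  obtain ⟨z, w, k1, k2, k3, k4, k5, k6⟩ := h'.exists_corner hf hf'
  have a1 : x * w = 0 := by rw [← h4, ← k5, mul_assoc, ← mul_assoc e', hef']; simp
  have a2 : z * y = 0 := by rw [← k4, ← h5, mul_assoc, ← mul_assoc f', hfe']; simp
  have a3 : y * z = 0 := by rw [← h6, ← k3, mul_assoc, ← mul_assoc e, hef]; simp
  have a4 : w * x = 0 := by rw [← k6, ← h3, mul_assoc, ← mul_assoc f, hfe]; simp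
  refine ⟨x + z, y + w, ?_, ?_⟩
  · simp [mul_add, add_mul, a1, a2, h1, k1]
  · simp [mul_add, add_mul, a3, a4, h2, k2]

/-- Conjugation of `a` by the unit `g`. -/
def conj (g : Rˣ) (a : R) : R := g * a * (g⁻¹ : Rˣ)

theorem conj_mul (g : Rˣ) (a b : R) : conj g (a * b) = conj g a * conj g b := by
  simp [conj, mul_assoc]

theorem conj_add (g : Rˣ) (a b : R) : conj g (a + b) = conj g a + conj g b := by
  simp [conj, mul_add, add_mul]

theorem conj_sub (g : Rˣ) (a b : R) : conj g (a - b) = conj g a - conj g b := by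
  simp [conj, mul_sub, sub_mul]

@[simp] theorem conj_one (g : Rˣ) : conj g 1 = 1 := by simp [conj]

@[simp] theorem conj_zero (g : Rˣ) : conj g 0 = 0 := by simp [conj]

theorem conj_inv_conj (g : Rˣ) (a : R) : conj g⁻¹ (conj g a) = a := by
  simp [conj, mul_assoc]

theorem conj_injective (g : Rˣ) : Function.Injective (conj g) :=
  Function.LeftInverse.injective (conj_inv_conj g)

theorem conj_eq_zero_iff (g : Rˣ) {a : R} : conj g a = 0 ↔ a = 0 := by
  simpa using (conj_injective g).eq_iff (a := a) (b := 0)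

theorem conj_eq_of_mul_eq (g : Rˣ) {a b : R} (h : g * a = b * g) : conj g a = b := by
  simp [conj, h, mul_assoc]

theorem AlgEquivalent.conj (g : Rˣ) {e : R} (he : IsIdempotentElem e) :
    AlgEquivalent e (conj g e) :=
  ⟨e * (g⁻¹ : Rˣ), g * e, by simp [mul_assoc, he.eq],
    by simp only [CStarK.conj, ← mul_assoc]; rw [mul_assoc (g : R), he.eq]⟩

/-- Two orthogonal decompositions of `1` into three idempotents which are pairwise equivalent are
conjugate. -/
theorem exists_conj_pair {e f e' f' : R} (he : IsIdempotentElem e) (hf : IsIdempotentElem f)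
    (he' : IsIdempotentElem e') (hf' : IsIdempotentElem f') (hef : e * f = 0) (hfe : f * e = 0)
    (hef' : e' * f' = 0) (hfe' : f' * e' = 0) (h : AlgEquivalent e e') (h' : AlgEquivalent f f')
    (h'' : AlgEquivalent (1 - (e + f)) (1 - (e' + f'))) :
    ∃ g : Rˣ, CStarK.conj g e = e' ∧ CStarK.conj g f = f' := by
  have hs := isIdempotentElem_add he hf hef hfe
  have hs' := isIdempotentElem_add he' hf' hef' hfe'
  obtain ⟨x, y, h1, h2, h3, h4, h5, h6⟩ := h.exists_corner he he'
  obtain ⟨z, w, k1, k2, k3, k4, k5, k6⟩ := h'.exists_corner hf hf'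
  obtain ⟨a, b, l1, l2, l3, l4, l5, l6⟩ := h''.exists_corner hs.one_sub hs'.one_sub
  have a1 : x * w = 0 := by rw [← h4, ← k5, mul_assoc, ← mul_assoc e', hef']; simp
  have a2 : z * y = 0 := by rw [← k4, ← h5, mul_assoc, ← mul_assoc f', hfe']; simp
  have a3 : y * z = 0 := by rw [← h6, ← k3, mul_assoc, ← mul_assoc e, hef]; simp
  have a4 : w * x = 0 := by rw [← k6, ← h3, mul_assoc, ← mul_assoc f, hfe]; simp
  have se : e * (1 - (e + f)) = 0 := by simp [mul_sub, mul_add, he.eq, hef]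
  have sf : f * (1 - (e + f)) = 0 := by simp [mul_sub, mul_add, hf.eq, hfe]
  have es : (1 - (e + f)) * e = 0 := by simp [sub_mul, add_mul, he.eq, hfe]
  have fs : (1 - (e + f)) * f = 0 := by simp [sub_mul, add_mul, hf.eq, hef]
  have se' : e' * (1 - (e' + f')) = 0 := by simp [mul_sub, mul_add, he'.eq, hef']
  have sf' : f' * (1 - (e' + f')) = 0 := by simp [mul_sub, mul_add, hf'.eq, hfe']
  have es' : (1 - (e' + f')) * e' = 0 := by simp [sub_mul, add_mul, he'.eq, hfe']
  have fs' : (1 - (e' + f')) * f' = 0 := by simp [sub_mul, add_mul, hf'.eq, hef']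
  have b1 : x * b = 0 := by rw [← h4, ← l5, mul_assoc, ← mul_assoc e', se']; simp
  have b2 : z * b = 0 := by rw [← k4, ← l5, mul_assoc, ← mul_assoc f', sf']; simp
  have b3 : a * y = 0 := by rw [← l4, ← h5, mul_assoc, ← mul_assoc _ e', es']; simp
  have b4 : a * w = 0 := by rw [← l4, ← k5, mul_assoc, ← mul_assoc _ f', fs']; simp
  have c1 : y * a = 0 := by rw [← h6, ← l3, mul_assoc, ← mul_assoc e, se]; simp
  have c2 : w * a = 0 := by rw [← k6, ← l3, mul_assoc, ← mul_assoc f, sf]; simp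
  have c3 : b * x = 0 := by rw [← l6, ← h3, mul_assoc, ← mul_assoc _ e, es]; simp
  have c4 : b * z = 0 := by rw [← l6, ← k3, mul_assoc, ← mul_assoc _ f, fs]; simp
  have d1 : w * e = 0 := by rw [← k6, mul_assoc, hfe, mul_zero]
  have d2 : b * e = 0 := by rw [← l6, mul_assoc, es, mul_zero]
  have d3 : e' * w = 0 := by rw [← k5, ← mul_assoc, hef', zero_mul]
  have d4 : e' * b = 0 := by rw [← l5, ← mul_assoc, se', zero_mul]
  have d5 : y * f = 0 := by rw [← h6, mul_assoc, hef, mul_zero]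
  have d6 : b * f = 0 := by rw [← l6, mul_assoc, fs, mul_zero]
  have d7 : f' * y = 0 := by rw [← h5, ← mul_assoc, hfe', zero_mul]
  have d8 : f' * b = 0 := by rw [← l5, ← mul_assoc, sf', zero_mul]
  -- The unit is glued from the three equivalences; all cross terms vanish by orthogonality.
  refine ⟨⟨y + w + b, x + z + a, ?_, ?_⟩, ?_, ?_⟩
  · simp only [mul_add, add_mul, a3, a4, h2, k2, l2, c1, c2, c3, c4]; abel
  · simp only [mul_add, add_mul, a1, a2, h1, k1, l1, b1, b2, b3, b4]; abel
  · exact conj_eq_of_mul_eq _ (by simp [mul_add, add_mul, d1, d2, d3, d4, h5, h6])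
  · exact conj_eq_of_mul_eq _ (by simp [mul_add, add_mul, d5, d6, d7, d8, k5, k6])

theorem exists_conj {e e' : R} (he : IsIdempotentElem e) (he' : IsIdempotentElem e')
    (h : AlgEquivalent e e') (h' : AlgEquivalent (1 - e) (1 - e')) :
    ∃ g : Rˣ, CStarK.conj g e = e' := by
  obtain ⟨g, hg, -⟩ := exists_conj_pair (f := 0) (f' := 0) he .zero he' .zero (by simp)
    (by simp) (by simp) (by simp) h (.refl .zero) (by simpa using h')
  exact ⟨g, hg⟩

end Ring

section CStar

variable {A : Type u} [CStarAlgebra A]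

/-! ### Idempotents and projections in a C*-algebra -/

/-- A finite sum of elements `z * star z` has a self-adjoint square root, which commutes with
everything the sum commutes with. -/
theorem exists_sqrt (x y : A) : ∃ c : A, star c = c ∧
    c * c = x * star x + y * star y ∧ ∀ b, Commute (x * star x + y * star y) b → Commute c b := by
  let _ := CStarAlgebra.spectralOrder A
  have := CStarAlgebra.spectralOrderedRing A
  have h0 : 0 ≤ x * star x + y * star y := add_nonneg (mul_star_self_nonneg x)
    (mul_star_self_nonneg y)
  exact ⟨CFC.sqrt (x * star x + y * star y), (CFC.sqrt_nonneg _).isSelfAdjoint,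
    CFC.sqrt_mul_sqrt_self _ h0, fun b hb => hb.cfcₙ_nnreal _⟩

theorem isUnit_one_add_mul_star (a : A) : IsUnit (1 + a * star a) := by
  let _ := CStarAlgebra.spectralOrder A
  have := CStarAlgebra.spectralOrderedRing A
  exact CStarAlgebra.isUnit_of_le (1 : A) (by simp)
    isStrictlyPositive_one

/-- Every idempotent of a C*-algebra has the same range as some projection. -/
theorem exists_range_projection {e : A} (he : IsIdempotentElem e) :
    ∃ p : A, IsStarProjection p ∧ e * p = p ∧ p * e = e := by
  -- Kaplansky's formula: `k` is self-adjoint, invertible and commutes with `e` and `star e`, and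
  -- the projection is `e * star e * k⁻¹`. The crucial identity is `k * e = e * star e * e`.
  obtain ⟨k, hk⟩ := isUnit_one_add_mul_star (e - star e)
  have hs : star e * star e = star e := by rw [← star_mul, he.eq]
  have hk' : (k : A) = 1 - e - star e + e * star e + star e * e := by
    rw [hk]; simp only [star_sub, star_star, mul_sub, sub_mul, he.eq, hs]; abel
  have h1 : e * k = e * star e * e := by
    rw [hk']; simp only [mul_sub, mul_add, mul_one, ← mul_assoc, he.eq]; abel
  have h2 : k * e = e * star e * e := by
    rw [hk']; simp only [sub_mul, add_mul, one_mul, mul_assoc, he.eq]; abel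
  have h3 : star e * k = k * star e := by
    rw [hk']
    simp only [mul_sub, mul_add, mul_one, ← mul_assoc, hs, sub_mul, add_mul, one_mul]
    simp only [mul_assoc, hs]; abel
  have c1 : Commute (k : A) (e * star e) := by
    unfold Commute SemiconjBy
    rw [← mul_assoc, h2, ← h1, mul_assoc, ← h3, mul_assoc]
  have c2 : Commute ((k⁻¹ : Aˣ) : A) (e * star e) := c1.units_inv_left
  have ks : star (k : A) = k := by rw [hk]; simp
  have kis : star ((k⁻¹ : Aˣ) : A) = (k⁻¹ : Aˣ) := by
    have : star k = k := Units.ext ks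
    rw [← Units.coe_star, star_inv, this]
  refine ⟨e * star e * (k⁻¹ : Aˣ), (isStarProjection_iff _).2 ⟨?_, ?_⟩, ?_, ?_⟩
  · have : e * star e * (e * star e) = e * star e * k := by
      rw [← mul_assoc, ← h1, mul_assoc, mul_assoc, h3]
    unfold IsIdempotentElem
    rw [mul_assoc, ← mul_assoc _ _ ((k⁻¹ : Aˣ) : A), c2.eq, ← mul_assoc, ← mul_assoc, this]
    simp [mul_assoc]
  · unfold IsSelfAdjoint
    rw [star_mul, kis, star_mul, star_star, c2.eq]
  · rw [← mul_assoc, ← mul_assoc, he.eq]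
  · rw [← c2.eq, mul_assoc, ← h2]; simp

/-- Algebraically equivalent projections are Murray-von Neumann equivalent. -/
theorem AlgEquivalent.exists_star {p q : A} (hp : IsStarProjection p) (hq : IsStarProjection q)
    (h : AlgEquivalent p q) : ∃ v : A, star v * v = p ∧ v * star v = q := by
  obtain ⟨x, y, h1, h2, h3, h4, h5, h6⟩ :=
    h.exists_corner hp.isIdempotentElem hq.isIdempotentElem
  have ps : star p = p := hp.isSelfAdjoint
  have qs : star q = q := hq.isSelfAdjoint
  have pi : p * p = p := hp.isIdempotentElem
  have qi : q * q = q := hq.isIdempotentElem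
  have s1 : star y * star x = p := by rw [← star_mul, h1, ps]
  have s2 : star x * star y = q := by rw [← star_mul, h2, qs]
  have s3 : star x * p = star x := by rw [← ps, ← star_mul, h3]
  have s6 : p * star y = star y := by rw [← ps, ← star_mul, h6]
  -- Polar decomposition of `y`: in the corner of `p` the inverse of `star y * y` is `x * star x`,
  -- so `c` acts there as `|y|⁻¹`, and `y * c` is the partial isometry.
  obtain ⟨c, cs, cc, hc⟩ := exists_sqrt x (1 - p)
  have e1 : (1 - p) * star (1 - p) = 1 - p := by simp [ps, mul_sub, sub_mul, pi]
  rw [e1] at cc hc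
  have cp : Commute c (star y * y) := by
    apply hc
    have a1 : star y * y * (x * star x) = p := by
      rw [mul_assoc, ← mul_assoc y, h2, ← qs, ← star_mul, h4, s1]
    have a2 : x * star x * (star y * y) = p := by
      rw [mul_assoc, ← mul_assoc (star x), s2, h5, h1]
    unfold Commute SemiconjBy
    rw [add_mul, mul_add, a1, a2]
    congr 1
    simp [sub_mul, mul_sub, ← mul_assoc, s6]; simp [mul_assoc, h6]
  refine ⟨y * c, ?_, ?_⟩
  · rw [star_mul, cs, mul_assoc, ← mul_assoc (star y), ← cp.eq, ← mul_assoc, cc, add_mul]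
    rw [mul_assoc x, ← mul_assoc (star x), s2, h5, h1, sub_mul, one_mul, ← mul_assoc, s6, sub_self,
      add_zero]
  · rw [star_mul, cs, mul_assoc, ← mul_assoc c, cc, add_mul, mul_add]
    rw [mul_assoc x, ← mul_assoc y, h2, s2, qi, sub_mul, one_mul, s6, sub_self, mul_zero, add_zero]

theorem isStarProjection_of_isometry_conj {s p : A} (hs : star s * s = 1)
    (hp : IsStarProjection p) : IsStarProjection (s * p * star s) := by
  have ps : star p = p := hp.isSelfAdjoint
  have pi : p * p = p := hp.isIdempotentElem
  refine (isStarProjection_iff _).2 ⟨?_, ?_⟩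
  · unfold IsIdempotentElem
    calc s * p * star s * (s * p * star s) = s * (p * (star s * s) * p) * star s := by
          simp only [mul_assoc]
      _ = _ := by rw [hs, mul_one, pi]
  · simp [IsSelfAdjoint, ps, mul_assoc]

theorem algEquivalent_isometry_conj {s p : A} (hs : star s * s = 1)
    (hp : IsIdempotentElem p) : AlgEquivalent p (s * p * star s) := by
  refine ⟨p * star s, s * p, ?_, ?_⟩
  · rw [mul_assoc, ← mul_assoc (star s), hs, one_mul, hp.eq]
  · rw [mul_assoc, ← mul_assoc p, hp.eq, mul_assoc]

/-! ### Simplicity, primeness, and isometries under projections -/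

theorem IsSimple.one_mem_of_dense (h : IsSimple A) (J : AddSubgroup A)
    (hl : ∀ x y, y ∈ J → x * y ∈ J) (hr : ∀ x y, x ∈ J → x * y ∈ J) {r : A} (hr0 : r ≠ 0)
    (hrJ : r ∈ J) : (1 : A) ∈ J := by
  -- The closure is a nonzero closed ideal, hence everything. So `J` has an element at distance less
  -- than `1` from `1`; it is invertible, which puts `1` itself in `J`.
  let I : TwoSidedIdeal A := TwoSidedIdeal.mk' (closure (J : Set A)) (subset_closure J.zero_mem)
    (fun hx hy => J.topologicalClosure.add_mem hx hy) (fun hx => J.topologicalClosure.neg_mem hx)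
    (fun {x _} hy => map_mem_closure (continuous_const_mul x) hy fun z hz => hl x z hz)
    (fun {_ y} hx => map_mem_closure (f := (· * y)) (continuous_mul_const y) hx
      fun z hz => hr z y hz)
  have hI : (I : Set A) = closure (J : Set A) := TwoSidedIdeal.coe_mk' ..
  have h1 : (1 : A) ∈ closure (J : Set A) := by
    rcases h.2 I (by rw [hI]; exact isClosed_closure) with h0 | h0
    · have : r ∈ (I : Set A) := by rw [hI]; exact subset_closure hrJ
      rw [h0] at this
      exact absurd this hr0
    · rw [← hI, h0]; trivial
  obtain ⟨z, hz, hd⟩ := Metric.mem_closure_iff.1 h1 1 one_pos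
  rw [dist_eq_norm] at hd
  have hu : IsUnit z := by simpa using (Units.oneSub (1 - z) hd).isUnit
  obtain ⟨w, rfl⟩ := hu
  simpa using hl (w⁻¹ : Aˣ) w hz

/-- The elements `z` with `z A b = 0` form a two-sided ideal; if it contains a nonzero `a` it
contains `1`, which kills `b`. -/
theorem IsSimple.prime (h : IsSimple A) {a b : A} (hab : ∀ x, a * x * b = 0) : a = 0 ∨ b = 0 := by
  by_contra! hne
  let J : AddSubgroup A :=
    { carrier := {z | ∀ x, z * x * b = 0}
      zero_mem' := by simp
      add_mem' := fun ha hb x => by simp only [add_mul, ha x, hb x, add_zero]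
      neg_mem' := fun ha x => by simp only [neg_mul, ha x, neg_zero] }
  have : (1 : A) ∈ J := h.one_mem_of_dense J
    (fun x y hy z => by rw [mul_assoc x, mul_assoc x, hy z, mul_zero])
    (fun x y hx z => by rw [mul_assoc x, hx]) hne.1 hab
  exact hne.2 (by simpa using this 1)

/-- In a simple C*-algebra, `1` is a finite sum of elements `a * r * b`, for every `r ≠ 0`. -/
theorem IsSimple.exists_list_sum_eq_one (h : IsSimple A) {r : A} (hr : r ≠ 0) :
    ∃ L : List (A × A), (L.map fun x => x.1 * r * x.2).sum = 1 := by
  let J : AddSubgroup A :=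
    { carrier := {z | ∃ L : List (A × A), (L.map fun x => x.1 * r * x.2).sum = z}
      zero_mem' := ⟨[], by simp⟩
      add_mem' := by
        rintro _ _ ⟨L, rfl⟩ ⟨L', rfl⟩
        exact ⟨L ++ L', by simp⟩
      neg_mem' := by
        rintro _ ⟨L, rfl⟩
        refine ⟨L.map fun x => (-x.1, x.2), ?_⟩
        rw [← neg_one_mul, ← List.sum_map_mul_left]
        simp [Function.comp_def, mul_assoc] }
  refine h.one_mem_of_dense J ?_ ?_ hr ⟨[(1, 1)], by simp⟩
  · rintro x _ ⟨L, rfl⟩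
    refine ⟨L.map fun y => (x * y.1, y.2), ?_⟩
    rw [← List.sum_map_mul_left]
    simp [Function.comp_def, mul_assoc]
  · rintro _ x ⟨L, rfl⟩
    refine ⟨L.map fun y => (y.1, y.2 * x), ?_⟩
    rw [← List.sum_map_mul_right]
    simp [Function.comp_def, mul_assoc]

/-- If `p w = w` and `w` is left invertible, then some isometry has range in `p`. -/
theorem exists_isometry_of_left_inverse {p y w : A} (hyw : y * w = 1) (hpw : p * w = w) :
    ∃ s : A, star s * s = 1 ∧ p * s = s := by
  have hi : IsIdempotentElem (w * y) := by
    unfold IsIdempotentElem; rw [mul_assoc, ← mul_assoc y, hyw, one_mul]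
  -- The idempotent `w * y` is equivalent to `y * w = 1`, so its range projection `q` is too; `q`
  -- lies under `p` because `p * w = w`.
  obtain ⟨q, hq, h1, h2⟩ := exists_range_projection hi
  have he : AlgEquivalent 1 q := by
    refine ⟨y * q, q * w, ?_, ?_⟩
    · have : q * w = w := by
        simpa [mul_assoc, hyw] using congrArg (· * w) h2
      rw [mul_assoc, ← mul_assoc q, hq.isIdempotentElem.eq, this, hyw]
    · rw [mul_assoc, ← mul_assoc w, h1, hq.isIdempotentElem.eq]
  obtain ⟨s, s1, s2⟩ := he.exists_star (.one A) hq
  refine ⟨s, s1, ?_⟩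
  have hpq : p * q = q := by rw [← h1, ← mul_assoc, ← mul_assoc, hpw]
  have hqs : q * s = s := by rw [← s2, mul_assoc, s1, mul_one]
  rw [← hqs, ← mul_assoc, hpq]

theorem eq_zero_of_star_mul_self_add {a b : A} (h : star a * a + star b * b = 0) : a = 0 := by
  let _ := CStarAlgebra.spectralOrder A
  have := CStarAlgebra.spectralOrderedRing A
  rw [← CStarRing.star_mul_self_eq_zero_iff]
  exact ((add_eq_zero_iff_of_nonneg (star_mul_self_nonneg a) (star_mul_self_nonneg b)).1 h).1

theorem mul_eq_self_of_star_mul_self {v p : A} (h : star v * v = p) (hp : IsStarProjection p) :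
    v * p = v := by
  have ps : star p = p := hp.isSelfAdjoint
  have pi : p * p = p := hp.isIdempotentElem
  have : v - v * p = 0 := by
    rw [← CStarRing.star_mul_self_eq_zero_iff]
    have e1 : star v * (v * p) = p := by rw [← mul_assoc, h, pi]
    simp [ps, mul_sub, sub_mul, mul_assoc, h, pi, e1]
  exact (sub_eq_zero.1 this).symm

/-- Under an infinite projection of a simple C*-algebra there is the range of an isometry. -/
theorem IsInfiniteProjection.exists_isometry (hA : IsSimple A) {p : A}
    (hp : IsInfiniteProjection p) : ∃ s : A, star s * s = 1 ∧ p * s = s := by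
  obtain ⟨hp, q, hq, hpq, hne, v, h1, h2⟩ := hp
  have ps : star p = p := hp.isSelfAdjoint
  have qs : star q = q := hq.isSelfAdjoint
  have pi : p * p = p := hp.isIdempotentElem
  have qi : q * q = q := hq.isIdempotentElem
  have hqp : q * p = q := by rw [← ps, ← qs, ← star_mul, hpq]
  have vp := mul_eq_self_of_star_mul_self h1 hp
  have qv : q * v = v := by rw [← h2, mul_assoc, h1, vp]
  have pv : p * v = v := by rw [← qv, ← mul_assoc, hpq]
  -- The defect `r` is nonzero, and the `v ^ i * r` are partial isometries with initial projection
  -- `r` and pairwise orthogonal ranges under `p`.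
  set r := p - q with hr
  have hr0 : r ≠ 0 := sub_ne_zero.2 hne.symm
  have rs : star r = r := by simp [hr, ps, qs]
  have pr : p * r = r := by simp [hr, mul_sub, pi, hpq]
  have rr : r * r = r := by simp [hr, mul_sub, sub_mul, pi, hpq, hqp, qi]
  have rv : r * v = 0 := by rw [← qv, ← mul_assoc]; simp [hr, sub_mul, hpq, qi]
  have vr : star v * r = 0 := by simpa [rs] using congrArg star rv
  have vpr (n : ℕ) : p * (v ^ n * r) = v ^ n * r := by
    cases n with
    | zero => simpa using pr
    | succ n => rw [pow_succ', mul_assoc, ← mul_assoc, pv]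
  have tt (i : ℕ) : star (v ^ i * r) * (v ^ i * r) = r := by
    induction i with
    | zero => simp [rs, rr]
    | succ n ih =>
      rw [pow_succ', mul_assoc, star_mul v, mul_assoc, ← mul_assoc (star v), h1, vpr, ih]
  have ts (i d : ℕ) : star (v ^ i * r) * (v ^ (i + (d + 1)) * r) = 0 := by
    induction i with
    | zero => simp [rs, pow_succ', ← mul_assoc, rv]
    | succ n ih =>
      rw [show n + 1 + (d + 1) = n + (d + 1) + 1 by ring, pow_succ', mul_assoc, star_mul v,
        pow_succ' v (n + (d + 1)), mul_assoc v, mul_assoc, ← mul_assoc (star v), h1, vpr, ih]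
  have ts' (i d : ℕ) : star (v ^ (i + (d + 1)) * r) * (v ^ i * r) = 0 := by
    simpa using congrArg star (ts i d)
  -- A sum of terms `a * r * b` becomes a single product `y * w`: each term gets its own power of
  -- `v`, and orthogonality of the ranges kills the cross terms. The parameter `k` reserves the
  -- powers below `k` for earlier terms.
  have key (L : List (A × A)) : ∀ k : ℕ, ∃ y w : A, y * w = (L.map fun x => x.1 * r * x.2).sum ∧
      p * w = w ∧ ∀ i < k, star (v ^ i * r) * w = 0 ∧ y * (v ^ i * r) = 0 := by
    induction L with
    | nil => exact fun k => ⟨0, 0, by simp⟩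
    | cons ab L ih =>
      intro k
      obtain ⟨y, w, e1, e2, e3⟩ := ih (k + 1)
      refine ⟨ab.1 * star (v ^ k * r) + y, v ^ k * r * ab.2 + w, ?_, ?_, ?_⟩
      · have f1 : ab.1 * star (v ^ k * r) * (v ^ k * r * ab.2) = ab.1 * r * ab.2 := by
          rw [mul_assoc, ← mul_assoc (star _), tt, mul_assoc]
        have f2 : ab.1 * star (v ^ k * r) * w = 0 := by
          rw [mul_assoc, (e3 k (by omega)).1, mul_zero]
        have f3 : y * (v ^ k * r * ab.2) = 0 := by
          rw [← mul_assoc, (e3 k (by omega)).2, zero_mul]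
        simp only [mul_add, add_mul, f1, f2, f3, e1, List.map_cons, List.sum_cons]
        abel
      · rw [mul_add, e2, ← mul_assoc, vpr]
      · intro i hi
        obtain ⟨d, rfl⟩ : ∃ d, k = i + (d + 1) := ⟨k - i - 1, by omega⟩
        constructor
        · rw [mul_add, (e3 i (by omega)).1, ← mul_assoc, ts, zero_mul, add_zero]
        · rw [add_mul, (e3 i (by omega)).2, mul_assoc, ts', mul_zero, add_zero]
  obtain ⟨L, hL⟩ := hA.exists_list_sum_eq_one hr0
  obtain ⟨y, w, e1, e2, -⟩ := key L 0
  exact exists_isometry_of_left_inverse (e1.trans hL) e2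

/-- The corner `p A p` of a projection. -/
def corner (p : A) (hp : IsStarProjection p) : NonUnitalStarSubalgebra ℂ A where
  carrier := {a | p * a * p = a}
  zero_mem' := by simp
  add_mem' := by
    intro a b ha hb
    simp only [Set.mem_ofPred_eq] at *
    rw [mul_add, add_mul, ha, hb]
  mul_mem' := by
    intro a b ha hb
    simp only [Set.mem_ofPred_eq] at *
    have h1 : p * a = a := by
      rw [← ha]; simp only [← mul_assoc, hp.isIdempotentElem.eq]
    have h2 : b * p = b := by
      rw [← hb]; simp only [mul_assoc, hp.isIdempotentElem.eq]
    rw [← mul_assoc, h1, mul_assoc, h2]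
  smul_mem' := by
    intro c a ha
    simp only [Set.mem_ofPred_eq] at *
    rw [mul_smul_comm, smul_mul_assoc, ha]
  star_mem' := by
    intro a ha
    simp only [Set.mem_ofPred_eq] at *
    have ps : star p = p := hp.isSelfAdjoint
    simpa [ps, mul_assoc] using congrArg star ha

theorem mem_corner {p : A} {hp : IsStarProjection p} {a : A} :
    a ∈ corner p hp ↔ p * a * p = a := Iff.rfl

theorem isHereditary_corner {p : A} (hp : IsStarProjection p) : IsHereditary (corner p hp) := by
  have ps : star p = p := hp.isSelfAdjoint
  have pi : p * p = p := hp.isIdempotentElem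
  refine ⟨?_, ?_⟩
  · change IsClosed {a : A | p * a * p = a}
    exact isClosed_eq (by fun_prop) continuous_id
  · rintro a b hb ⟨y, rfl⟩ ⟨z, hz⟩
    rw [mem_corner] at hb ⊢
    have hp1 : p * (1 - p) = 0 := by simp [mul_sub, pi]
    -- Compressing `b = star y * y + star z * z` to `1 - p` gives zero, a sum of two positive terms.
    have h0 : y * (1 - p) = 0 := by
      apply eq_zero_of_star_mul_self_add (b := z * (1 - p))
      have hs : star (1 - p) = 1 - p := by simp [ps]
      calc star (y * (1 - p)) * (y * (1 - p)) + star (z * (1 - p)) * (z * (1 - p))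
          = (1 - p) * (star y * y + star z * z) * (1 - p) := by
            simp only [star_mul, hs, mul_add, add_mul, mul_assoc]
        _ = (1 - p) * b * (1 - p) := by rw [← hz]; congr 2; abel
        _ = 0 := by rw [← hb]; simp only [mul_assoc, hp1, mul_zero]
    have hy : y * p = y := by rw [mul_sub, mul_one, sub_eq_zero] at h0; exact h0.symm
    have hy' : p * star y = star y := by simpa [ps] using congrArg star hy
    rw [← mul_assoc, hy', mul_assoc, hy]

/-- Every nonzero projection in a simple purely infinite C*-algebra dominates the range of an
isometry. -/
theorem IsPurelyInfinite.exists_isometry (hA : IsSimple A) (hpi : IsPurelyInfinite A) {p : A}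
    (hp : IsStarProjection p) (hp0 : p ≠ 0) : ∃ s : A, star s * s = 1 ∧ p * s = s := by
  have hne : corner p hp ≠ ⊥ := by
    intro h
    have : p ∈ corner p hp := by
      rw [mem_corner, hp.isIdempotentElem.eq, hp.isIdempotentElem.eq]
    rw [h] at this
    exact hp0 (NonUnitalStarAlgebra.mem_bot.1 this)
  obtain ⟨q, hq, hinf⟩ := hpi _ (isHereditary_corner hp) hne
  obtain ⟨s, s1, s2⟩ := hinf.exists_isometry hA
  refine ⟨s, s1, ?_⟩
  have : p * q = q := by
    rw [mem_corner] at hq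
    rw [← hq]; simp only [← mul_assoc, hp.isIdempotentElem.eq]
  rw [← s2, ← mul_assoc, this]

/-- A simple purely infinite C*-algebra contains two isometries with orthogonal ranges. -/
theorem IsPurelyInfinite.exists_orthogonal_isometries (hA : IsSimple A)
    (hpi : IsPurelyInfinite A) :
    ∃ s t : A, star s * s = 1 ∧ star t * t = 1 ∧ star s * t = 0 ∧ star t * s = 0 := by
  have := hA.1
  obtain ⟨p, -, hp, q, hq, hpq, hne, v, h1, h2⟩ :=
    hpi _ (isHereditary_corner (.one A)) (by
      intro h
      have : (1 : A) ∈ corner 1 (.one A) := by simp [mem_corner]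
      rw [h] at this
      exact one_ne_zero (NonUnitalStarAlgebra.mem_bot.1 this))
  have ps : star p = p := hp.isSelfAdjoint
  have qs : star q = q := hq.isSelfAdjoint
  have pi : p * p = p := hp.isIdempotentElem
  have hqp : q * p = q := by rw [← ps, ← qs, ← star_mul, hpq]
  have vp := mul_eq_self_of_star_mul_self h1 hp
  have qv : q * v = v := by rw [← h2, mul_assoc, h1, vp]
  have pv : p * v = v := by rw [← qv, ← mul_assoc, hpq]
  have vp' : star v * p = star v := by simpa [ps] using congrArg star pv
  have pv' : p * star v = star v := by simpa [ps] using congrArg star vp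
  -- Adding `1 - p` to `v` gives an isometry with range projection `q + (1 - p)`, which leaves room
  -- for `t` under `p - q`.
  obtain ⟨t, t1, t3⟩ := hpi.exists_isometry hA (hq.sub_of_mul_eq_left hp hqp)
    (sub_ne_zero.2 hne.symm)
  have e1 : star v * t = 0 := by
    have : star v * q = star v := by simpa [qs] using congrArg star qv
    rw [← t3, ← mul_assoc, mul_sub, vp', this, sub_self, zero_mul]
  have e2 : (1 - p) * t = 0 := by
    rw [← t3, ← mul_assoc]; simp [sub_mul, mul_sub, pi, hpq]
  have e3 : star (v + (1 - p)) * t = 0 := by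
    rw [star_add, add_mul, e1, star_sub, star_one, ps, e2, add_zero]
  refine ⟨v + (1 - p), t, ?_, t1, e3, by simpa using congrArg star e3⟩
  simp only [star_add, star_sub, star_one, ps, add_mul, mul_add, mul_sub, sub_mul, mul_one,
    one_mul, h1, vp', pv, pi]
  abel

end CStar

section KTheory

variable {A : Type u} [CStarAlgebra A]

/-! ### Classes of idempotents of the algebra itself -/

/-- An element of `A`, viewed as a `1 × 1` matrix. -/
def oneByOne (p : A) : Matrix (Fin 1) (Fin 1) A := Matrix.of fun _ _ => p

theorem oneByOne_mul (a b : A) : oneByOne a * oneByOne b = oneByOne (a * b) := by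
  ext i j
  simp [oneByOne, Matrix.mul_apply]

theorem oneByOne_conjTranspose (a : A) : (oneByOne a)ᴴ = oneByOne (star a) := rfl

theorem isStarProjection_oneByOne {p : A} (hp : IsStarProjection p) :
    IsStarProjection (oneByOne p) := by
  refine (isStarProjection_iff _).2 ⟨?_, ?_⟩
  · rw [IsIdempotentElem, oneByOne_mul, hp.isIdempotentElem.eq]
  · rw [IsSelfAdjoint, Matrix.star_eq_conjTranspose, oneByOne_conjTranspose,
      hp.isSelfAdjoint.star_eq]

theorem mvN_oneByOne {p q : A} :
    MvN (oneByOne p) (oneByOne q) ↔ ∃ v : A, star v * v = p ∧ v * star v = q := by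
  constructor
  · rintro ⟨v, h1, h2⟩
    refine ⟨v 0 0, ?_, ?_⟩
    · simpa [Matrix.mul_apply, oneByOne] using congrFun₂ h1 0 0
    · simpa [Matrix.mul_apply, oneByOne] using congrFun₂ h2 0 0
  · rintro ⟨v, rfl, rfl⟩
    exact ⟨oneByOne v, by rw [oneByOne_conjTranspose, oneByOne_mul],
      by rw [oneByOne_conjTranspose, oneByOne_mul]⟩

/-- A projection of `A`, viewed as a projection in `M_1(A)`. -/
def MatProj.ofProj (p : A) (hp : IsStarProjection p) : MatProj A where
  size := 1
  mat := oneByOne p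
  isProj := isStarProjection_oneByOne hp

theorem V.mk_eq_mk {p q : MatProj A} : V.mk p = V.mk q ↔ MvN p.mat q.mat :=
  ⟨fun h => Quotient.exact (s := MatProj.setoid A) h, V.sound⟩

open Classical in
/-- The class in `V A` of an idempotent of `A`, that is, of a projection with the same range. -/
noncomputable def vClass (e : A) : V A :=
  if he : IsIdempotentElem e then
    V.mk (MatProj.ofProj _ (exists_range_projection he).choose_spec.1) else 0

theorem vClass_spec {e : A} (he : IsIdempotentElem e) :
    ∃ (p : A) (hp : IsStarProjection p), AlgEquivalent e p ∧
      vClass e = V.mk (MatProj.ofProj p hp) := by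
  have h := (exists_range_projection he).choose_spec
  exact ⟨_, h.1, ⟨_, _, h.2.2, h.2.1⟩, by rw [vClass, dif_pos he]⟩

theorem vClass_eq_vClass_iff {e f : A} (he : IsIdempotentElem e) (hf : IsIdempotentElem f) :
    vClass e = vClass f ↔ AlgEquivalent e f := by
  obtain ⟨p, hp, h1, h2⟩ := vClass_spec he
  obtain ⟨q, hq, h3, h4⟩ := vClass_spec hf
  rw [h2, h4, V.mk_eq_mk]
  constructor
  · intro h
    obtain ⟨v, h5, h6⟩ := mvN_oneByOne.1 h
    exact (h1.trans he hq.isIdempotentElem ⟨_, _, h5, h6⟩).trans he hf h3.symm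
  · intro h
    exact mvN_oneByOne.2 (AlgEquivalent.exists_star hp hq ((h1.symm.trans hp.isIdempotentElem hf
      h).trans hp.isIdempotentElem hq.isIdempotentElem h3))

theorem vClass_proj {p : A} (hp : IsStarProjection p) :
    vClass p = V.mk (MatProj.ofProj p hp) := by
  obtain ⟨q, hq, h1, h2⟩ := vClass_spec hp.isIdempotentElem
  rw [h2, V.mk_eq_mk]
  exact mvN_oneByOne.2 (h1.symm.exists_star hq hp)

theorem vClass_one : vClass (1 : A) = V.mk MatProj.one := by
  rw [vClass_proj (.one A), V.mk_eq_mk]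
  have : (oneByOne 1 : Matrix (Fin 1) (Fin 1) A) = 1 := by
    ext i j
    rw [Subsingleton.elim i j, Matrix.one_apply_eq]
    rfl
  change MvN (oneByOne 1) (1 : Matrix (Fin 1) (Fin 1) A)
  exact ⟨1, by simp [this], by simp⟩

theorem vClass_eq_zero_iff {e : A} (he : IsIdempotentElem e) : vClass e = 0 ↔ e = 0 := by
  obtain ⟨p, hp, h1, h2⟩ := vClass_spec he
  rw [h1.eq_zero_iff he hp.isIdempotentElem, h2]
  change V.mk _ = V.mk MatProj.zero ↔ _
  rw [V.mk_eq_mk]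
  change MvN (oneByOne p) (0 : Matrix (Fin 0) (Fin 0) A) ↔ _
  constructor
  · rintro ⟨v, h3, -⟩
    have : v = 0 := by ext i; exact i.elim0
    rw [this, Matrix.mul_zero] at h3
    exact (congrFun₂ h3 0 0).symm
  · rintro rfl
    exact ⟨0, by ext i j; simp [oneByOne], by ext i; exact i.elim0⟩

theorem vClass_add_of_proj {p q : A} (hp : IsStarProjection p) (hq : IsStarProjection q)
    (hpq : p * q = 0) (hqp : q * p = 0) : vClass (p + q) = vClass p + vClass q := by
  have ps : star p = p := hp.isSelfAdjoint
  have qs : star q = q := hq.isSelfAdjoint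
  have pi : p * p = p := hp.isIdempotentElem
  have qi : q * q = q := hq.isIdempotentElem
  have hs : IsStarProjection (p + q) := (isStarProjection_iff _).2
    ⟨isIdempotentElem_add pi qi hpq hqp, by simp [IsSelfAdjoint, ps, qs]⟩
  rw [vClass_proj hp, vClass_proj hq, vClass_proj hs, V.mk_add, V.mk_eq_mk]
  refine MvN.trans (MatProj.idem _) (MatProj.idem _) (MvN.symm
    (?_ : MvN (blockSum (oneByOne p) (oneByOne q)) (oneByOne (p + q)))) (MatProj.mvN_add _ _)
  -- The row `(p, q)` implements the equivalence.
  let v : Matrix (Fin 1) (Fin 1 ⊕ Fin 1) A := Matrix.of fun _ => Sum.elim (fun _ => p) fun _ => q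
  refine ⟨v, ?_, ?_⟩
  · ext i j
    rcases i with i | i <;> rcases j with j | j <;>
      simp [v, Matrix.mul_apply, blockSum, oneByOne, ps, qs, pi, qi, hpq, hqp]
  · ext i j
    simp [v, Matrix.mul_apply, oneByOne, ps, qs, pi, qi]

/-- A simple purely infinite C*-algebra contains a sequence of isometries with pairwise orthogonal
ranges. -/
theorem exists_isometry_seq (hA : IsSimple A) (hpi : IsPurelyInfinite A) :
    ∃ s : ℕ → A, ∀ i j, star (s i) * s j = if i = j then 1 else 0 := by
  obtain ⟨s, t, s1, t1, st, ts⟩ := hpi.exists_orthogonal_isometries hA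
  have tn (i : ℕ) : star (t ^ i) * t ^ i = 1 := by
    induction i with
    | zero => simp
    | succ i ih =>
      rw [pow_succ', star_mul, mul_assoc, ← mul_assoc (star t), t1, one_mul, ih]
  have e1 (i : ℕ) : star (t ^ i * s) * (t ^ i * s) = 1 := by
    rw [star_mul, mul_assoc, ← mul_assoc (star (t ^ i)), tn, one_mul, s1]
  have e2 (i d : ℕ) : star (t ^ i * s) * (t ^ (i + (d + 1)) * s) = 0 := by
    rw [star_mul, mul_assoc, pow_add, mul_assoc (t ^ i), ← mul_assoc (star (t ^ i)), tn, one_mul,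
      pow_succ', mul_assoc t, ← mul_assoc, st, zero_mul]
  have e3 (i j : ℕ) : star (t ^ i * s) * (t ^ j * s) = if i = j then 1 else 0 := by
    rcases lt_trichotomy i j with h | h | h
    · obtain ⟨d, rfl⟩ : ∃ d, j = i + (d + 1) := ⟨j - i - 1, by omega⟩
      rw [e2, if_neg (by omega)]
    · rw [h, e1, if_pos rfl]
    · obtain ⟨d, rfl⟩ : ∃ d, i = j + (d + 1) := ⟨i - j - 1, by omega⟩
      rw [if_neg (by omega)]
      simpa using congrArg star (e2 j d)
  exact ⟨fun i => t ^ i * s, e3⟩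

theorem exists_vClass_eq (hA : IsSimple A) (hpi : IsPurelyInfinite A)
    (x : V A) : ∃ p : A, IsStarProjection p ∧ vClass p = x := by
  obtain ⟨s, hs⟩ := exists_isometry_seq hA hpi
  induction x using Quotient.inductionOn with
  | h P =>
  obtain ⟨n, P, hP⟩ := P
  -- A row of `n` isometries with orthogonal ranges is itself an isometry, so `P ↦ r P rᴴ` carries
  -- projections of `M_n(A)` to equivalent ones in `A`.
  let r : Matrix (Fin 1) (Fin n) A := Matrix.of fun _ i => s i
  have hr : rᴴ * r = 1 := by
    ext i j
    simp only [r, Matrix.mul_apply, Matrix.conjTranspose_apply, Matrix.of_apply,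
      Finset.univ_unique, Finset.sum_const, Finset.card_singleton, one_smul, hs, Matrix.one_apply,
      Fin.ext_iff]
  have hi : P * P = P := hP.isIdempotentElem
  have hPs : Pᴴ = P := hP.isSelfAdjoint
  have hq1 : oneByOne ((r * P * rᴴ) 0 0) = r * P * rᴴ := by
    ext i j
    simp [oneByOne, Subsingleton.elim i 0, Subsingleton.elim j 0]
  have hqq : (r * P * rᴴ) * (r * P * rᴴ) = r * P * rᴴ := by
    calc (r * P * rᴴ) * (r * P * rᴴ) = r * (P * (rᴴ * r) * P) * rᴴ := by
          simp only [Matrix.mul_assoc]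
      _ = _ := by rw [hr, Matrix.mul_one, hi]
  have hqs : (r * P * rᴴ)ᴴ = r * P * rᴴ := by
    simp only [Matrix.conjTranspose_mul, Matrix.conjTranspose_conjTranspose, hPs, Matrix.mul_assoc]
  have hq : IsStarProjection ((r * P * rᴴ) 0 0) := by
    refine (isStarProjection_iff _).2 ⟨?_, congrFun₂ hqs 0 0⟩
    have := congrFun₂ hqq 0 0
    rwa [Matrix.mul_apply, Finset.univ_unique, Finset.sum_singleton] at this
  refine ⟨_, hq, ?_⟩
  rw [vClass_proj hq]
  refine V.sound (MvN.symm ?_)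
  change MvN P (oneByOne _)
  rw [hq1]
  refine ⟨r * P, ?_, ?_⟩
  · rw [Matrix.conjTranspose_mul, Matrix.mul_assoc, ← Matrix.mul_assoc rᴴ, hr, Matrix.one_mul,
      hPs,      hi]
  · rw [Matrix.conjTranspose_mul, hPs, Matrix.mul_assoc, ← Matrix.mul_assoc P, hi, Matrix.mul_assoc]

/-- Orthogonal idempotents need not have orthogonal range projections, so these are first moved
under two isometries with orthogonal ranges. -/
theorem vClass_add (hA : IsSimple A) (hpi : IsPurelyInfinite A)
    {e f : A} (he : IsIdempotentElem e) (hf : IsIdempotentElem f)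
    (hef : e * f = 0) (hfe : f * e = 0) : vClass (e + f) = vClass e + vClass f := by
  obtain ⟨s, t, s1, t1, st, ts⟩ := hpi.exists_orthogonal_isometries hA
  obtain ⟨p, hp, h1, -⟩ := vClass_spec he
  obtain ⟨q, hq, h2, -⟩ := vClass_spec hf
  have hp' := isStarProjection_of_isometry_conj s1 hp
  have hq' := isStarProjection_of_isometry_conj t1 hq
  have h1' := h1.trans he hp'.isIdempotentElem (algEquivalent_isometry_conj s1 hp.isIdempotentElem)
  have h2' := h2.trans hf hq'.isIdempotentElem (algEquivalent_isometry_conj t1 hq.isIdempotentElem)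
  have o1 : s * p * star s * (t * q * star t) = 0 := by
    rw [mul_assoc, mul_assoc t, ← mul_assoc (star s), st, zero_mul, mul_zero]
  have o2 : t * q * star t * (s * p * star s) = 0 := by
    rw [mul_assoc, mul_assoc s, ← mul_assoc (star t), ts, zero_mul, mul_zero]
  rw [(vClass_eq_vClass_iff he hp'.isIdempotentElem).2 h1',
    (vClass_eq_vClass_iff hf hq'.isIdempotentElem).2 h2', ← vClass_add_of_proj hp' hq' o1 o2,
    vClass_eq_vClass_iff (isIdempotentElem_add he hf hef hfe) (isIdempotentElem_add
      hp'.isIdempotentElem hq'.isIdempotentElem o1 o2)]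
  exact h1'.add he hf hp'.isIdempotentElem hq'.isIdempotentElem hef hfe o1 o2 h2'

/-- Every class is represented by a projection lying properly under a given nonzero projection. -/
theorem exists_proj_lt (hA : IsSimple A) (hpi : IsPurelyInfinite A)
    (x : V A) {q : A} (hq : IsStarProjection q) (hq0 : q ≠ 0) :
    ∃ p : A, IsStarProjection p ∧ vClass p = x ∧ q * p = p ∧ p * q = p ∧ p ≠ q := by
  obtain ⟨p, hp, rfl⟩ := exists_vClass_eq hA hpi x
  obtain ⟨w, w1, w2⟩ := hpi.exists_isometry hA hq hq0
  obtain ⟨s, t, s1, t1, st, ts⟩ := hpi.exists_orthogonal_isometries hA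
  have := hA.1
  have h1 : star (w * s) * (w * s) = 1 := by
    rw [star_mul, mul_assoc, ← mul_assoc (star w), w1, one_mul, s1]
  have hp' := isStarProjection_of_isometry_conj h1 hp
  have hqp : q * (w * s * p * star (w * s)) = w * s * p * star (w * s) := by
    simp only [← mul_assoc, w2]
  have qs : star q = q := hq.isSelfAdjoint
  refine ⟨_, hp', ?_, hqp, ?_, ?_⟩
  · exact ((vClass_eq_vClass_iff hp.isIdempotentElem hp'.isIdempotentElem).2
      (algEquivalent_isometry_conj h1 hp.isIdempotentElem)).symm
  · have := congrArg star hqp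
    rwa [star_mul, hp'.isSelfAdjoint.star_eq, qs] at this
  -- The new projection kills `w * t`, whereas `q` fixes it.
  · intro h
    have h2 : w * s * p * star (w * s) * (w * t) = 0 := by
      rw [mul_assoc, star_mul, mul_assoc (star s), ← mul_assoc (star w), w1, one_mul, st, mul_zero]
    rw [h, ← mul_assoc, w2] at h2
    have h3 : star (w * t) * (w * t) = 1 := by
      rw [star_mul, mul_assoc, ← mul_assoc (star w), w1, one_mul, t1]
    rw [h2, mul_zero] at h3
    exact zero_ne_one h3

/-- Any class fits strictly inside any nonzero one. This makes the nonzero classes a group, which is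
the source of cancellation. -/
theorem exists_add_eq (hA : IsSimple A) (hpi : IsPurelyInfinite A)
    (x : V A) {y : V A} (hy : y ≠ 0) : ∃ z, z ≠ 0 ∧ x + z = y := by
  obtain ⟨q, hq, rfl⟩ := exists_vClass_eq hA hpi y
  have hq0 : q ≠ 0 := fun h => hy ((vClass_eq_zero_iff hq.isIdempotentElem).2 h)
  obtain ⟨p, hp, rfl, h1, h2, h3⟩ := exists_proj_lt hA hpi x hq hq0
  have hd : IsIdempotentElem (q - p) := by
    simp [IsIdempotentElem, mul_sub, sub_mul, h1, h2, hp.isIdempotentElem.eq,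
      hq.isIdempotentElem.eq]
  refine ⟨vClass (q - p), ?_, ?_⟩
  · rw [Ne, vClass_eq_zero_iff hd, sub_eq_zero]
    exact h3.symm
  · rw [← vClass_add hA hpi hp.isIdempotentElem hd, add_sub_cancel]
    · rw [mul_sub, h2, hp.isIdempotentElem.eq, sub_self]
    · rw [sub_mul, h1, hp.isIdempotentElem.eq, sub_self]

/-! ### `K₀` as the set of classes of nonzero projections -/

/-- The class in `K₀(A)` of an idempotent of `A`. -/
noncomputable def kClass (e : A) : KZero A := Algebra.GrothendieckAddGroup.of (vClass e)

theorem kClass_one : kClass (1 : A) = KZero.unitClass A := by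
  rw [kClass, vClass_one, KZero.unitClass]

theorem kClass_eq_of_algEquivalent {e f : A} (he : IsIdempotentElem e) (hf : IsIdempotentElem f)
    (h : AlgEquivalent e f) : kClass e = kClass f :=
  congrArg Algebra.GrothendieckAddGroup.of ((vClass_eq_vClass_iff he hf).2 h)

theorem kClass_conj (g : Aˣ) {e : A} (he : IsIdempotentElem e) :
    kClass (conj g e) = kClass e :=
  (kClass_eq_of_algEquivalent he (by rw [IsIdempotentElem, ← conj_mul, he.eq])
    (AlgEquivalent.conj g he)).symm

theorem kClass_add (hA : IsSimple A) (hpi : IsPurelyInfinite A)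
    {e f : A} (he : IsIdempotentElem e) (hf : IsIdempotentElem f)
    (hef : e * f = 0) (hfe : f * e = 0) : kClass (e + f) = kClass e + kClass f := by
  rw [kClass, vClass_add hA hpi he hf hef hfe, map_add]; rfl

theorem kClass_one_sub (hA : IsSimple A) (hpi : IsPurelyInfinite A)
    {e : A} (he : IsIdempotentElem e) :
    kClass (1 - e) = KZero.unitClass A - kClass e := by
  rw [eq_sub_iff_add_eq, ← kClass_add hA hpi he.one_sub he, sub_add_cancel, kClass_one]
  · rw [sub_mul, he.eq, one_mul, sub_self]
  · rw [mul_sub, he.eq, mul_one, sub_self]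

/-- Equality in the Grothendieck group means `c + x = c + y` for some `c`. A class `z` with `x + z =
x` also satisfies `z + y = y`, since `y` has the form `x + w`; writing `z = c + d` then cancels `c`.
-/
theorem of_injective_of_ne_zero (hA : IsSimple A) (hpi : IsPurelyInfinite A)
    {x y : V A} (hx : x ≠ 0) (hy : y ≠ 0)
    (h : Algebra.GrothendieckAddGroup.of x = Algebra.GrothendieckAddGroup.of y) : x = y := by
  obtain ⟨c, hc⟩ := ((AddLocalization.addMonoidOf (⊤ : AddSubmonoid (V A))).eq_iff_exists).1 h
  obtain ⟨z, hz, hzx⟩ := exists_add_eq hA hpi x hx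
  obtain ⟨d, -, hd⟩ := exists_add_eq hA hpi (c : V A) hz
  obtain ⟨w, -, hw⟩ := exists_add_eq hA hpi x hy
  have h1 : z + y = y := by rw [← hw, ← add_assoc, add_comm z, hzx]
  rw [← hzx, ← h1, ← hd, add_comm x, add_comm (c : V A) d, add_assoc, hc, add_assoc]

theorem AlgEquivalent.of_kClass_eq (hA : IsSimple A) (hpi : IsPurelyInfinite A)
    {e f : A} (he : IsIdempotentElem e) (hf : IsIdempotentElem f)
    (he0 : e ≠ 0) (hf0 : f ≠ 0) (h : kClass e = kClass f) : AlgEquivalent e f :=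
  (vClass_eq_vClass_iff he hf).1 (of_injective_of_ne_zero hA hpi
    (by rwa [Ne, vClass_eq_zero_iff he]) (by rwa [Ne, vClass_eq_zero_iff hf]) h)

/-- Every element of `K₀` is the class of a nonzero projection lying properly under a given nonzero
projection. -/
theorem exists_kClass_eq (hA : IsSimple A) (hpi : IsPurelyInfinite A)
    (k : KZero A) {q : A} (hq : IsStarProjection q) (hq0 : q ≠ 0) :
    ∃ p : A, IsStarProjection p ∧ kClass p = k ∧ p ≠ 0 ∧ q * p = p ∧ p * q = p ∧ p ≠ q := by
  have := hA.1
  obtain ⟨x, y, hx, hxy⟩ : ∃ x y : V A, x ≠ 0 ∧ k + Algebra.GrothendieckAddGroup.of y =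
      Algebra.GrothendieckAddGroup.of x := by
    obtain ⟨⟨x, y, hy⟩, hxy⟩ := (AddLocalization.addMonoidOf (⊤ : AddSubmonoid (V A))).surj k
    have hxy' : k + Algebra.GrothendieckAddGroup.of y = Algebra.GrothendieckAddGroup.of x := hxy
    by_cases hx : x = 0
    -- Adding the class of `1` to both terms of the formal difference makes the first one nonzero.
    · refine ⟨x + vClass 1, y + vClass 1, ?_, by rw [map_add, map_add, ← add_assoc, hxy']⟩
      rw [hx, zero_add, Ne, vClass_eq_zero_iff .one]
      exact one_ne_zero
    · exact ⟨x, y, hx, hxy'⟩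
  obtain ⟨z, hz, rfl⟩ := exists_add_eq hA hpi y hx
  obtain ⟨p, hp, h0, h1, h2, h3⟩ := exists_proj_lt hA hpi z hq hq0
  refine ⟨p, hp, ?_, ?_, h1, h2, h3⟩
  · rw [map_add, add_comm] at hxy
    rw [kClass, h0]
    exact (add_left_cancel hxy).symm
  · rintro rfl
    exact hz (h0 ▸ (vClass_eq_zero_iff .zero).2 rfl)

end KTheory

/-! ### The map on idempotents induced by an isomorphism of general linear groups -/

section Reflection

variable {R : Type*} [Ring R]

theorem one_sub_add_self_mul_self {e : R} (he : IsIdempotentElem e) :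
    (1 - (e + e)) * (1 - (e + e)) = 1 := by
  simp only [mul_sub, sub_mul, mul_add, add_mul, he.eq, mul_one, one_mul]
  abel

open Classical in
/-- The unit `1 - 2e` attached to an idempotent `e`. -/
noncomputable def reflection (e : R) : Rˣ :=
  if he : IsIdempotentElem e then
    ⟨1 - (e + e), 1 - (e + e), one_sub_add_self_mul_self he, one_sub_add_self_mul_self he⟩
  else 1

theorem coe_reflection {e : R} (he : IsIdempotentElem e) :
    (reflection e : R) = 1 - (e + e) := by
  rw [reflection, dif_pos he]

/-- The idempotent `e + f - 2ef`, the symmetric difference of commuting idempotents. -/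
def xor (e f : R) : R := e + f - (e * f + e * f)

theorem xor_one_sub_left (e f : R) : xor (1 - e) f = 1 - xor e f := by
  simp only [xor, sub_mul, one_mul]; abel

theorem xor_one_sub_right (e f : R) : xor e (1 - f) = 1 - xor e f := by
  simp only [xor, mul_sub, mul_one]; abel

theorem isIdempotentElem_xor {e f : R} (he : IsIdempotentElem e) (hf : IsIdempotentElem f)
    (h : Commute e f) : IsIdempotentElem (xor e f) := by
  have h1 : f * e = e * f := h.eq.symm
  have h2 : e * (e * f) = e * f := by rw [← mul_assoc, he.eq]
  have h3 : e * f * e = e * f := by rw [mul_assoc, h1, h2]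
  have h4 : f * (e * f) = e * f := by rw [← mul_assoc, h1, mul_assoc, hf.eq]
  have h5 : e * f * f = e * f := by rw [mul_assoc, hf.eq]
  have h6 : e * f * (e * f) = e * f := by rw [← mul_assoc, h3, h5]
  simp only [IsIdempotentElem, xor, mul_sub, sub_mul, mul_add, add_mul, he.eq, hf.eq, h1, h2, h3,
    h4, h5, h6]
  abel

theorem reflection_mul_reflection {e f : R} (he : IsIdempotentElem e) (hf : IsIdempotentElem f)
    (h : Commute e f) : reflection e * reflection f = reflection (xor e f) := by
  ext
  rw [Units.val_mul, coe_reflection he, coe_reflection hf,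
    coe_reflection (isIdempotentElem_xor he hf h), xor]
  simp only [mul_sub, sub_mul, mul_add, add_mul, mul_one, one_mul]
  abel

theorem isIdempotentElem_conj (g : Rˣ) {e : R} (he : IsIdempotentElem e) :
    IsIdempotentElem (conj g e) := by
  rw [IsIdempotentElem, ← conj_mul, he.eq]

theorem reflection_conj (g : Rˣ) {e : R} (he : IsIdempotentElem e) :
    reflection (conj g e) = g * reflection e * g⁻¹ := by
  ext
  rw [coe_reflection (isIdempotentElem_conj g he), Units.val_mul, Units.val_mul, coe_reflection he,
    ← conj_add, ← conj_one g, ← conj_sub, conj_one, conj]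

theorem reflection_zero : reflection (0 : R) = 1 := by
  ext
  rw [coe_reflection .zero]
  simp

/-- The bicentralizer of `{e, f}` contains no idempotents besides those generated by `e`, `f`
through complements and symmetric differences. -/
def BicentralizerSmall (e f : R) : Prop :=
  ∀ h : R, IsIdempotentElem h →
    (∀ g : Rˣ, Commute (g : R) e → Commute (g : R) f → Commute (g : R) h) →
    h = 0 ∨ h = 1 ∨ h = e ∨ h = 1 - e ∨ h = f ∨ h = 1 - f ∨ h = xor e f ∨ h = 1 - xor e f

/-- It suffices to test the list on `e * f`: each of its eight possible values forces one of the
products to vanish. -/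
theorem BicentralizerSmall.mul_eq_zero {e f : R} (he : IsIdempotentElem e)
    (hf : IsIdempotentElem f) (hc : Commute e f) (h : BicentralizerSmall e f) :
    e * f = 0 ∨ e * (1 - f) = 0 ∨ (1 - e) * f = 0 ∨ (1 - e) * (1 - f) = 0 := by
  have h1 : e * (e * f) = e * f := by rw [← mul_assoc, he.eq]
  have h2 : e * f * f = e * f := by rw [mul_assoc, hf.eq]
  rcases h (e * f) (he.mul_of_commute hc hf) fun g h1 h2 => h1.mul_right h2 with
    h | h | h | h | h | h | h | h
  · exact .inl h
  · have : (1 : R) * f = 1 := by rw [← h, h2]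
    exact .inr <| .inl <| by rw [one_mul] at this; simp [this]
  · exact .inr <| .inl <| by rw [mul_sub, h, mul_one, sub_self]
  · have := congrArg (e * ·) h
    simp only [h1, mul_sub, he.eq, mul_one, sub_self] at this
    exact .inl this
  · exact .inr <| .inr <| .inl <| by rw [sub_mul, h, one_mul, sub_self]
  · have := congrArg (· * f) h
    simp only [h2, sub_mul, hf.eq, one_mul, sub_self] at this
    exact .inl this
  · have := congrArg (fun x => e * x * f) h
    simp only [xor, mul_sub, mul_add, sub_mul, add_mul, h1, h2, he.eq] at this
    exact .inl (by simpa using this)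
  · refine .inr <| .inr <| .inr ?_
    have h3 : (1 - e) * (1 - f) = 1 - xor e f - e * f := by
      simp only [xor, mul_sub, sub_mul, mul_one, one_mul]; abel
    rw [h3, ← h, sub_self]

end Reflection

/-! ### Bicentralizers in simple C*-algebras -/

section CStar

variable {A : Type u} [CStarAlgebra A]

theorem exists_isUnit_one_add_smul (a : A) : ∃ t : ℂ, t ≠ 0 ∧ IsUnit (1 + t • a) := by
  have hpos : 0 < ‖a‖ + 1 := by positivity
  refine ⟨((‖a‖ + 1)⁻¹ : ℝ), by exact_mod_cast inv_ne_zero hpos.ne', ?_⟩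
  have hlt : ‖-((((‖a‖ + 1)⁻¹ : ℝ) : ℂ) • a)‖ < 1 := by
    rw [norm_neg, norm_smul, Complex.norm_real, Real.norm_of_nonneg (by positivity),
      inv_mul_lt_iff₀ hpos]
    linarith
  simpa using (Units.oneSub _ hlt).isUnit

theorem eq_of_add_self_eq {a b : A} (h : a + a = b + b) : a = b := by
  have h2 : (2 : ℂ) • a = (2 : ℂ) • b := by rw [two_smul, two_smul, h]
  exact smul_right_injective A (two_ne_zero : (2 : ℂ) ≠ 0) h2

theorem commute_of_commute_one_sub_add_self {a e : A} (h : Commute a (1 - (e + e))) :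
    Commute a e := by
  have h1 : a * (e + e) = (e + e) * a := by
    have := h.eq
    rw [mul_sub, sub_mul, mul_one, one_mul] at this
    exact sub_right_injective this
  rw [mul_add, add_mul] at h1
  exact eq_of_add_self_eq h1

theorem commute_reflection_right_iff {a e : A} (he : IsIdempotentElem e) :
    Commute a (reflection e : A) ↔ Commute a e := by
  rw [coe_reflection he]
  exact ⟨commute_of_commute_one_sub_add_self,
    fun h => (Commute.one_right a).sub_right (h.add_right h)⟩

/-- If all units in a corner `pAp` (plus scalars) commute with `e` and `f`, then an idempotent `h`
commuting with `p` and with all units that commute with `e` and `f` contains `p` or is orthogonal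
to it. -/
theorem eq_zero_or_eq_of_commute_units (hA : IsSimple A) {e f p h : A}
    (h2 : IsIdempotentElem h) (hhp : Commute h p)
    (hpa : ∀ a, Commute (p * a * p) e ∧ Commute (p * a * p) f)
    (hc : ∀ g : Aˣ, Commute (g : A) e → Commute (g : A) f → Commute (g : A) h) :
    h * p = 0 ∨ h * p = p := by
  -- A small multiple of a corner element plus `1` is a unit, so commuting with units gives
  -- commuting with the whole corner.
  have key (a : A) : Commute (p * a * p) h := by
    obtain ⟨t, ht, g, hg⟩ := exists_isUnit_one_add_smul (p * a * p)
    have h3 := hc g (by rw [hg]; exact (Commute.one_left _).add_left ((hpa a).1.smul_left t))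
      (by rw [hg]; exact (Commute.one_left _).add_left ((hpa a).2.smul_left t))
    rw [hg] at h3
    have h4 : Commute (t • (p * a * p)) h := by
      simpa using h3.sub_left (Commute.one_left h)
    simpa [smul_smul, inv_mul_cancel₀ ht] using h4.smul_left t⁻¹
  -- An `h` central on the corner `pAp` splits it into two pieces with nothing in between; primeness
  -- makes one of them zero.
  have h0 (a : A) : h * p * a * (p - h * p) = 0 := by
    calc h * p * a * (p - h * p) = h * (p * a * p) - h * (p * a * (h * p)) := by
          rw [mul_sub]; simp only [mul_assoc]
      _ = h * (p * a * p) - h * ((p * a * p) * h) := by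
          rw [hhp.eq]; simp only [mul_assoc]
      _ = 0 := by rw [(key a).eq, ← mul_assoc h h, h2.eq, sub_self]
  rcases hA.prime h0 with h | h
  · exact .inl h
  · exact .inr (sub_eq_zero.1 h).symm

/-- The atoms are `e`, `f` and `1 - (e + f)`. An idempotent of the bicentralizer contains or avoids
each of them, hence is one of the `2 ^ 3` sums of atoms, and these are exactly the listed ones. -/
theorem bicentralizerSmall_of_orthogonal (hA : IsSimple A) {e f : A} (he : IsIdempotentElem e)
    (hf : IsIdempotentElem f) (hef : e * f = 0) (hfe : f * e = 0) : BicentralizerSmall e f := by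
  intro h hh hc
  have ce : Commute h e := by
    refine ((commute_reflection_right_iff he).1 ?_)
    refine (hc (reflection e) ?_ ?_).symm <;> rw [coe_reflection he]
    · exact (Commute.one_left _).sub_left ((Commute.refl e).add_left (Commute.refl e))
    · have : Commute e f := by rw [Commute, SemiconjBy, hef, hfe]
      exact (Commute.one_left _).sub_left (this.add_left this)
  have cf : Commute h f := by
    refine ((commute_reflection_right_iff hf).1 ?_)
    refine (hc (reflection f) ?_ ?_).symm <;> rw [coe_reflection hf]
    · have : Commute f e := by rw [Commute, SemiconjBy, hef, hfe]
      exact (Commute.one_left _).sub_left (this.add_left this)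
    · exact (Commute.one_left _).sub_left ((Commute.refl f).add_left (Commute.refl f))
  set k := 1 - (e + f) with hk
  have ck : Commute h k := (Commute.one_right h).sub_right (ce.add_right cf)
  have ke : k * e = 0 := by simp [hk, sub_mul, add_mul, he.eq, hfe]
  have ek : e * k = 0 := by simp [hk, mul_sub, mul_add, he.eq, hef]
  have kf : k * f = 0 := by simp [hk, sub_mul, add_mul, hf.eq, hef]
  have fk : f * k = 0 := by simp [hk, mul_sub, mul_add, hf.eq, hfe]
  have c0 {p q : A} (h1 : p * q = 0) (h2 : q * p = 0) (a : A) : Commute (p * a * p) q := by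
    rw [Commute, SemiconjBy, mul_assoc, h1, ← mul_assoc, ← mul_assoc, h2]; simp
  have c1 {p : A} (hp : IsIdempotentElem p) (a : A) : Commute (p * a * p) p := by
    rw [Commute, SemiconjBy, mul_assoc, hp.eq, ← mul_assoc, ← mul_assoc, hp.eq]
  have de := eq_zero_or_eq_of_commute_units hA hh ce
    (fun a => ⟨c1 he a, c0 hef hfe a⟩) hc
  have df := eq_zero_or_eq_of_commute_units hA hh cf
    (fun a => ⟨c0 hfe hef a, c1 hf a⟩) hc
  have dk := eq_zero_or_eq_of_commute_units hA hh ck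
    (fun a => ⟨c0 ke ek a, c0 kf fk a⟩) hc
  have hsum : h = h * e + h * f + h * k := by
    rw [hk, mul_sub, mul_add, mul_one]; abel
  have hx : xor e f = e + f := by simp [xor, hef]
  rw [hx]
  rcases de with de | de <;> rcases df with df | df <;> rcases dk with dk | dk <;>
    rw [de, df, dk] at hsum <;> simp only [hsum, hk]
  · simp
  · simp
  · simp
  · right; right; right; left; abel
  · simp
  · right; right; right; right; right; left; abel
  · simp
  · right; left; abel

theorem eq_zero_or_one_of_commute_units (hA : IsSimple A) {h : A} (hh : IsIdempotentElem h)
    (hc : ∀ g : Aˣ, Commute (g : A) h) : h = 0 ∨ h = 1 := by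
  simpa using eq_zero_or_eq_of_commute_units (e := 0) (f := 0) (p := 1) hA hh
    (.one_right h) (by simp) fun g _ _ => hc g

/-! ### The induced map on idempotents -/

variable {B : Type v} [CStarAlgebra B] (φ : Aˣ ≃* Bˣ)

/-- The map on idempotents induced by `φ` through `e ↦ 1 - 2e`. -/
noncomputable def idemMap (e : A) : B := (2⁻¹ : ℂ) • (1 - (φ (reflection e) : B))

theorem idemMap_add_self (e : A) : idemMap φ e + idemMap φ e = 1 - (φ (reflection e) : B) := by
  rw [idemMap, ← add_smul]; norm_num

theorem coe_map_reflection (e : A) :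
    (φ (reflection e) : B) = 1 - (idemMap φ e + idemMap φ e) := by
  rw [idemMap_add_self, sub_sub_cancel]

theorem isIdempotentElem_idemMap {e : A} (he : IsIdempotentElem e) :
    IsIdempotentElem (idemMap φ e) := by
  have h1 : reflection e * reflection e = 1 := by
    ext
    rw [Units.val_mul, coe_reflection he, one_sub_add_self_mul_self he, Units.val_one]
  have h2 : (φ (reflection e) : B) * φ (reflection e) = 1 := by
    rw [← Units.val_mul, ← map_mul, h1, map_one, Units.val_one]
  rw [IsIdempotentElem, idemMap, smul_mul_smul_comm]
  rw [show (1 - (φ (reflection e) : B)) * (1 - (φ (reflection e) : B)) =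
    (2 : ℂ) • (1 - (φ (reflection e) : B)) by
      rw [two_smul, sub_mul, mul_sub, mul_sub, h2, one_mul, one_mul, mul_one]; abel, smul_smul]
  norm_num

theorem reflection_idemMap {e : A} (he : IsIdempotentElem e) :
    reflection (idemMap φ e) = φ (reflection e) := by
  ext
  rw [coe_reflection (isIdempotentElem_idemMap φ he), coe_map_reflection]

theorem eq_idemMap_of_reflection {e : A} {f : B} (hf : IsIdempotentElem f)
    (h : reflection f = φ (reflection e)) : f = idemMap φ e := by
  have := congrArg Units.val h
  rw [coe_reflection hf, coe_map_reflection] at this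
  exact eq_of_add_self_eq (sub_right_injective this)

theorem idemMap_symm_idemMap {e : A} (he : IsIdempotentElem e) :
    idemMap φ.symm (idemMap φ e) = e :=
  (eq_idemMap_of_reflection φ.symm he (by rw [reflection_idemMap φ he, φ.symm_apply_apply])).symm

theorem idemMap_idemMap_symm {f : B} (hf : IsIdempotentElem f) :
    idemMap φ (idemMap φ.symm f) = f := by
  simpa using idemMap_symm_idemMap φ.symm hf

theorem idemMap_injective {e f : A} (he : IsIdempotentElem e) (hf : IsIdempotentElem f)
    (h : idemMap φ e = idemMap φ f) : e = f := by
  rw [← idemMap_symm_idemMap φ he, h, idemMap_symm_idemMap φ hf]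

theorem idemMap_conj (g : Aˣ) {e : A} (he : IsIdempotentElem e) :
    idemMap φ (conj g e) = conj (φ g) (idemMap φ e) := by
  refine (eq_idemMap_of_reflection φ
    (isIdempotentElem_conj _ (isIdempotentElem_idemMap φ he)) ?_).symm
  rw [reflection_conj _ (isIdempotentElem_idemMap φ he), reflection_idemMap φ he,
    reflection_conj g he, map_mul, map_mul, map_inv]

theorem commute_units_idemMap_iff (g : Aˣ) {e : A} (he : IsIdempotentElem e) :
    Commute (φ g : B) (idemMap φ e) ↔ Commute (g : A) e := by
  rw [← commute_reflection_right_iff he,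
    ← commute_reflection_right_iff (isIdempotentElem_idemMap φ he), reflection_idemMap φ he,
    commute_iff_eq, commute_iff_eq, ← Units.val_mul, ← Units.val_mul, ← Units.val_mul,
    ← Units.val_mul, Units.val_inj, Units.val_inj, ← map_mul, ← map_mul, φ.injective.eq_iff]

theorem commute_idemMap {e f : A} (he : IsIdempotentElem e) (hf : IsIdempotentElem f)
    (h : Commute e f) : Commute (idemMap φ e) (idemMap φ f) := by
  rw [← commute_reflection_right_iff (isIdempotentElem_idemMap φ hf), reflection_idemMap φ hf]
  refine ((commute_units_idemMap_iff φ _ he).2 ?_).symm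
  exact ((commute_reflection_right_iff hf).2 h).symm

theorem idemMap_xor {e f : A} (he : IsIdempotentElem e) (hf : IsIdempotentElem f)
    (h : Commute e f) : idemMap φ (xor e f) = xor (idemMap φ e) (idemMap φ f) := by
  have he' := isIdempotentElem_idemMap φ he
  have hf' := isIdempotentElem_idemMap φ hf
  have h' := commute_idemMap φ he hf h
  refine (eq_idemMap_of_reflection φ (isIdempotentElem_xor he' hf' h') ?_).symm
  rw [← reflection_mul_reflection he' hf' h', ← reflection_mul_reflection he hf h, map_mul,
    reflection_idemMap φ he, reflection_idemMap φ hf]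

theorem idemMap_zero : idemMap φ (0 : A) = 0 :=
  (eq_idemMap_of_reflection φ .zero (by rw [reflection_zero, reflection_zero, map_one])).symm

/-- The reflection of `1` is `-1`, whose image under `φ` is a central involution different from `1`,
hence `-1`. -/
theorem idemMap_one (hA : IsSimple A) (hB : IsSimple B) : idemMap φ (1 : A) = 1 := by
  have := hA.1
  refine (eq_zero_or_one_of_commute_units hB (isIdempotentElem_idemMap φ .one)
    fun g => ?_).resolve_left fun h => ?_
  · obtain ⟨g, rfl⟩ := φ.surjective g
    exact (commute_units_idemMap_iff φ g .one).2 (.one_right _)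
  · exact one_ne_zero (idemMap_injective φ .one .zero (h.trans (idemMap_zero φ).symm))

theorem idemMap_one_sub (hA : IsSimple A) (hB : IsSimple B) {e : A} (he : IsIdempotentElem e) :
    idemMap φ (1 - e) = 1 - idemMap φ e := by
  have h1 : xor 1 e = 1 - e := by simp [xor]
  have h2 : xor 1 (idemMap φ e) = 1 - idemMap φ e := by simp [xor]
  rw [← h1, idemMap_xor φ .one he (.one_left e), idemMap_one φ hA hB, h2]

/-- The condition involves only commutation with units, complements and symmetric differences, all
of which `idemMap` preserves. -/
theorem BicentralizerSmall.map (hA : IsSimple A) (hB : IsSimple B) {e f : A}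
    (he : IsIdempotentElem e) (hf : IsIdempotentElem f) (hc : Commute e f)
    (h : BicentralizerSmall e f) :
    BicentralizerSmall (idemMap φ e) (idemMap φ f) := by
  intro k hk hkc
  have hk' := isIdempotentElem_idemMap φ.symm hk
  have hx := isIdempotentElem_xor he hf hc
  have := h (idemMap φ.symm k) hk' fun g h1 h2 => by
    have := hkc (φ g) ((commute_units_idemMap_iff φ g he).2 h1)
      ((commute_units_idemMap_iff φ g hf).2 h2)
    simpa using (commute_units_idemMap_iff φ.symm (φ g) hk).2 this
  rw [← idemMap_idemMap_symm φ hk, ← idemMap_xor φ he hf hc]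
  rcases this with h | h | h | h | h | h | h | h <;> rw [h]
  · simp [idemMap_zero]
  · simp [idemMap_one φ hA hB]
  · simp
  · simp [idemMap_one_sub φ hA hB he]
  · simp
  · simp [idemMap_one_sub φ hA hB hf]
  · simp
  · simp [idemMap_one_sub φ hA hB hx]

end CStar

/-! ### Recovering `K₀` -/

/-- Unital simple purely infinite C*-algebras. -/
class IsPISimple (A : Type u) [CStarAlgebra A] : Prop where
  simple : IsSimple A
  purelyInfinite : IsPurelyInfinite A

/-- Nonzero orthogonal idempotents whose sum is not `1`. -/
structure StrictlyOrthogonal {R : Type*} [Ring R] (e f : R) : Prop where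
  idem_left : IsIdempotentElem e
  idem_right : IsIdempotentElem f
  mul_eq : e * f = 0
  mul_eq' : f * e = 0
  left_ne : e ≠ 0
  right_ne : f ≠ 0
  add_ne : e + f ≠ 1

/-- Idempotents different from `0` and `1`. -/
structure NontrivialIdem {R : Type*} [Ring R] (e : R) : Prop where
  idem : IsIdempotentElem e
  ne_zero : e ≠ 0
  ne_one : e ≠ 1

section Ring

variable {R : Type*} [Ring R] {e f : R}

theorem StrictlyOrthogonal.symm (h : StrictlyOrthogonal e f) : StrictlyOrthogonal f e :=
  ⟨h.2, h.1, h.4, h.3, h.6, h.5, by rw [add_comm]; exact h.7⟩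

theorem StrictlyOrthogonal.commute (h : StrictlyOrthogonal e f) : Commute e f :=
  h.mul_eq.trans h.mul_eq'.symm

theorem StrictlyOrthogonal.left (h : StrictlyOrthogonal e f) : NontrivialIdem e :=
  ⟨h.1, h.5, fun h1 => h.6 (by simpa [h1] using h.3)⟩

theorem StrictlyOrthogonal.right (h : StrictlyOrthogonal e f) : NontrivialIdem f := h.symm.left

theorem StrictlyOrthogonal.idem_add (h : StrictlyOrthogonal e f) : IsIdempotentElem (e + f) :=
  isIdempotentElem_add h.1 h.2 h.3 h.4

theorem StrictlyOrthogonal.add (h : StrictlyOrthogonal e f) : NontrivialIdem (e + f) :=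
  ⟨h.idem_add, fun h1 => h.5 (by simpa [mul_add, h.1.eq, h.3] using congrArg (e * ·) h1), h.7⟩

theorem NontrivialIdem.one_sub (h : NontrivialIdem e) : NontrivialIdem (1 - e) :=
  ⟨h.1.one_sub, fun h1 => h.3 (sub_eq_zero.1 h1).symm, fun h1 => h.2 (by simpa using h1)⟩

end Ring

/-! ### Choosing between an image and its complement, class by class -/

section SignedMap

variable {A : Type u} [CStarAlgebra A] {B : Type v} [CStarAlgebra B] (φ : Aˣ ≃* Bˣ)

/-- Whether orthogonal idempotents of class `k` are mapped to orthogonal idempotents. -/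
def SignPos (k : KZero A) : Prop :=
  ∃ e f : A, StrictlyOrthogonal e f ∧ kClass e = k ∧ kClass f = k ∧ idemMap φ e * idemMap φ f = 0

open Classical in
/-- The induced map on idempotents, corrected so as to preserve orthogonality. -/
noncomputable def signedMap (e : A) : B :=
  if SignPos φ (kClass e) then idemMap φ e else 1 - idemMap φ e

variable {φ}

theorem signedMap_eq_or (e : A) :
    signedMap φ e = idemMap φ e ∨ signedMap φ e = 1 - idemMap φ e := by
  rw [signedMap]; split_ifs <;> simp

theorem signedMap_conj (g : Aˣ) {e : A} (he : IsIdempotentElem e) :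
    signedMap φ (conj g e) = conj (φ g) (signedMap φ e) := by
  rw [signedMap, signedMap, kClass_conj g he, idemMap_conj φ g he]
  split_ifs
  · rfl
  · rw [conj_sub, conj_one]

theorem signedMap_injective {e f : A} (he : IsIdempotentElem e) (hf : IsIdempotentElem f)
    (hk : kClass e = kClass f) (h : signedMap φ e = signedMap φ f) : e = f := by
  apply idemMap_injective φ he hf
  rw [signedMap, signedMap, hk] at h
  split_ifs at h
  · exact h
  · exact sub_right_injective h

theorem StrictlyOrthogonal.commute_signedMap {e f : A} (h : StrictlyOrthogonal e f) :
    Commute (signedMap φ e) (signedMap φ f) := by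
  have hc := commute_idemMap φ h.1 h.2 h.commute
  rcases signedMap_eq_or (φ := φ) e with h1 | h1 <;>
    rcases signedMap_eq_or (φ := φ) f with h2 | h2 <;> rw [h1, h2]
  · exact hc
  · exact (Commute.one_right _).sub_right hc
  · exact (Commute.one_left _).sub_left hc
  · exact ((Commute.one_right _).sub_right ((Commute.one_left _).sub_left hc))

end SignedMap

/-! ### Conjugacy of idempotents with equal classes -/

section KTheory

variable {A : Type u} [CStarAlgebra A] [hA : IsPISimple A]

theorem NontrivialIdem.exists_conj {e e' : A} (h : NontrivialIdem e) (h' : NontrivialIdem e')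
    (hk : kClass e = kClass e') : ∃ g : Aˣ, conj g e = e' := by
  refine CStarK.exists_conj h.1 h'.1
    (.of_kClass_eq hA.1 hA.2 h.1 h'.1 h.2 h'.2 hk)
    (.of_kClass_eq hA.1 hA.2 h.one_sub.1 h'.one_sub.1 h.one_sub.2 h'.one_sub.2 ?_)
  rw [kClass_one_sub hA.1 hA.2 h.1, kClass_one_sub hA.1 hA.2 h'.1, hk]

/-- The remainders `1 - (e + f)` and `1 - (e' + f')` have equal class, and both are nonzero, so they
are equivalent as well. This is where `add_ne` is needed. -/
theorem StrictlyOrthogonal.exists_conj {e f e' f' : A} (h : StrictlyOrthogonal e f)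
    (h' : StrictlyOrthogonal e' f') (hk : kClass e = kClass e') (hk' : kClass f = kClass f') :
    ∃ g : Aˣ, conj g e = e' ∧ conj g f = f' := by
  refine exists_conj_pair h.1 h.2 h'.1 h'.2 h.3 h.4 h'.3 h'.4
    (.of_kClass_eq hA.1 hA.2 h.1 h'.1 h.5 h'.5 hk) (.of_kClass_eq hA.1 hA.2 h.2 h'.2 h.6 h'.6 hk')
    (.of_kClass_eq hA.1 hA.2 h.add.one_sub.1 h'.add.one_sub.1 h.add.one_sub.2 h'.add.one_sub.2 ?_)
  rw [kClass_one_sub hA.1 hA.2 h.idem_add, kClass_one_sub hA.1 hA.2 h'.idem_add,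
    kClass_add hA.1 hA.2 h.1 h.2 h.3 h.4, kClass_add hA.1 hA.2 h'.1 h'.2 h'.3 h'.4, hk, hk']

/-- Arbitrary sequences of classes are represented by orthogonal idempotents. -/
theorem exists_seq (k : ℕ → KZero A) :
    ∃ p : ℕ → A, (∀ i, kClass (p i) = k i) ∧ ∀ i j, i ≠ j → StrictlyOrthogonal (p i) (p j) := by
  have := hA.1.1
  obtain ⟨s, hs⟩ := exists_isometry_seq hA.1 hA.2
  choose q hq hk hq0 hq' using fun i => exists_kClass_eq hA.1 hA.2 (k i) (.one A) one_ne_zero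
  have s1 (i : ℕ) : star (s i) * s i = 1 := by simp [hs]
  have s0 {i j : ℕ} (h : i ≠ j) : star (s i) * s j = 0 := by simp [hs, h]
  have hp (i : ℕ) := (isStarProjection_of_isometry_conj (s1 i) (hq i)).isIdempotentElem
  have hpq (i : ℕ) := algEquivalent_isometry_conj (s1 i) (hq i).isIdempotentElem
  have h0 {i j : ℕ} (h : i ≠ j) : s i * q i * star (s i) * s j = 0 := by
    rw [mul_assoc, s0 h, mul_zero]
  have h00 {i j : ℕ} (h : i ≠ j) :
      s i * q i * star (s i) * (s j * q j * star (s j)) = 0 := by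
    rw [← mul_assoc, ← mul_assoc, h0 h, zero_mul, zero_mul]
  have hne (i : ℕ) : s i * q i * star (s i) ≠ 0 := fun h =>
    hq0 i (((hpq i).eq_zero_iff (hq i).isIdempotentElem (hp i)).2 h)
  refine ⟨fun i => s i * q i * star (s i), fun i => ?_, fun i j hij =>
    ⟨hp i, hp j, h00 hij, h00 hij.symm, hne i, hne j, fun h => ?_⟩⟩
  · rw [← hk i]
    exact (kClass_eq_of_algEquivalent (hq i).isIdempotentElem (hp i) (hpq i)).symm
  -- Both idempotents kill the isometry of index `i + j + 1`, so their sum is not `1`.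
  · have h1 := congrArg (· * s (i + j + 1)) h
    simp only [add_mul, h0 (show i ≠ i + j + 1 by omega), h0 (show j ≠ i + j + 1 by omega),
      one_mul, add_zero] at h1
    have := s1 (i + j + 1)
    rw [← h1, mul_zero] at this
    exact zero_ne_one this

theorem exists_nontrivialIdem (k : KZero A) : ∃ e : A, NontrivialIdem e ∧ kClass e = k := by
  obtain ⟨p, hp, hpo⟩ := exists_seq fun _ => k
  exact ⟨p 0, (hpo 0 1 (by omega)).left, hp 0⟩

/-! ### The signed map on orthogonal idempotents -/

variable {B : Type v} [CStarAlgebra B] {φ : Aˣ ≃* Bˣ}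

/-- Polynomial identities between images of orthogonal idempotents depend only on the classes. -/
theorem StrictlyOrthogonal.exists_conj_signedMap {e f e' f' : A} (h : StrictlyOrthogonal e f)
    (h' : StrictlyOrthogonal e' f') (hk : kClass e = kClass e') (hk' : kClass f = kClass f') :
    ∃ g : Bˣ, conj g (signedMap φ e) = signedMap φ e' ∧
      conj g (signedMap φ f) = signedMap φ f' := by
  obtain ⟨g, rfl, rfl⟩ := h.exists_conj h' hk hk'
  exact ⟨φ g, (signedMap_conj g h.1).symm, (signedMap_conj g h.2).symm⟩

variable [hB : IsPISimple B]

theorem nontrivialIdem_idemMap (φ : Aˣ ≃* Bˣ) {e : A} (h : NontrivialIdem e) :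
    NontrivialIdem (idemMap φ e) :=
  ⟨isIdempotentElem_idemMap φ h.1,
    fun h0 => h.2 (idemMap_injective φ h.1 .zero (h0.trans (idemMap_zero φ).symm)),
    fun h0 => h.3 (idemMap_injective φ h.1 .one (h0.trans (idemMap_one φ hA.1 hB.1).symm))⟩

theorem nontrivialIdem_signedMap {e : A} (h : NontrivialIdem e) :
    NontrivialIdem (signedMap φ e) := by
  rcases signedMap_eq_or (φ := φ) e with h1 | h1 <;> rw [h1]
  exacts [nontrivialIdem_idemMap φ h, (nontrivialIdem_idemMap φ h).one_sub]

/-- This comes from the bicentralizer of the images under `idemMap`; the four alternatives are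
merely permuted when an image is replaced by its complement. -/
theorem StrictlyOrthogonal.signedMap_cases {e f : A} (h : StrictlyOrthogonal e f) :
    signedMap φ e * signedMap φ f = 0 ∨ signedMap φ e * (1 - signedMap φ f) = 0 ∨
      (1 - signedMap φ e) * signedMap φ f = 0 ∨
      (1 - signedMap φ e) * (1 - signedMap φ f) = 0 := by
  have := ((bicentralizerSmall_of_orthogonal hA.1 h.1 h.2 h.3 h.4).map φ hA.1 hB.1 h.1 h.2
    h.commute).mul_eq_zero (isIdempotentElem_idemMap φ h.1) (isIdempotentElem_idemMap φ h.2)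
    (commute_idemMap φ h.1 h.2 h.commute)
  rcases signedMap_eq_or (φ := φ) e with h1 | h1 <;>
    rcases signedMap_eq_or (φ := φ) f with h2 | h2 <;> rw [h1, h2] <;>
    (try simp only [sub_sub_cancel]) <;> tauto

/-- For a positive sign, orthogonality is carried over from the witness by conjugation. For a
negative sign, some unit swaps the two images, so an inclusion between them would be an equality,
against injectivity; orthogonal complements would make the sign positive. -/
theorem StrictlyOrthogonal.signedMap_mul_of_kClass_eq {e f : A} (h : StrictlyOrthogonal e f)
    (hk : kClass e = kClass f) : signedMap φ e * signedMap φ f = 0 := by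
  by_cases hs : SignPos φ (kClass e)
  · obtain ⟨e', f', h', h1, h2, h3⟩ := id hs
    obtain ⟨g, h4, h5⟩ := h'.exists_conj_signedMap (φ := φ) h h1 (h2.trans hk)
    rw [← h4, ← h5, ← conj_mul, conj_eq_zero_iff, signedMap, signedMap, h1, h2,
      if_pos hs, if_pos hs, h3]
  · have hne : signedMap φ e ≠ signedMap φ f := fun h1 => by
      have := signedMap_injective h.1 h.2 hk h1
      have h2 := h.3
      rw [← this, h.1.eq] at h2
      exact h.5 h2
    obtain ⟨g, h4, h5⟩ := h.exists_conj_signedMap (φ := φ) h.symm hk hk.symm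
    have hc := h.commute_signedMap (φ := φ)
    have key {e' f' : B} (h1 : e' * (1 - f') = 0) (h2 : f' * (1 - e') = 0) (h3 : Commute e' f') :
        e' = f' := by
      rw [mul_sub, mul_one, sub_eq_zero] at h1 h2
      rw [h1, h3.eq, ← h2]
    rcases h.signedMap_cases (φ := φ) with h1 | h1 | h1 | h1
    · exact h1
    · have h2 := congrArg (conj g) h1
      rw [conj_mul, conj_sub, conj_one, conj_zero, h4, h5] at h2
      exact absurd (key h1 h2 hc) hne
    · have h2 := congrArg (conj g) h1
      rw [conj_mul, conj_sub, conj_one, conj_zero, h4, h5] at h2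
      rw [((Commute.one_left _).sub_left hc).eq] at h1
      rw [((Commute.one_left _).sub_left hc.symm).eq] at h2
      exact absurd (key h2 h1 hc) hne
    · refine absurd ⟨e, f, h, rfl, hk.symm, ?_⟩ hs
      rw [signedMap, signedMap, ← hk, if_neg hs, if_neg hs] at h1
      simpa using h1

/-- Take two orthogonal copies of each class. By conjugacy a relation between the images of one
mixed pair holds for every mixed pair. If the image of `p 0` lay under that of `p 2`, it would also
lie under that of `p 3`, which is orthogonal to the former; the other bad cases are similar. -/
theorem StrictlyOrthogonal.signedMap_mul {e f : A} (h : StrictlyOrthogonal e f) :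
    signedMap φ e * signedMap φ f = 0 := by
  obtain ⟨p, hk, hp⟩ := exists_seq fun i => if i < 2 then kClass e else kClass f
  have k0 : kClass (p 0) = kClass e := hk 0
  have k1 : kClass (p 1) = kClass e := hk 1
  have k2 : kClass (p 2) = kClass f := hk 2
  have k3 : kClass (p 3) = kClass f := hk 3
  have h01 := hp 0 1 (by omega)
  have h02 := hp 0 2 (by omega)
  have h03 := hp 0 3 (by omega)
  have h12 := hp 1 2 (by omega)
  have h23 := hp 2 3 (by omega)
  have o01 := h01.signedMap_mul_of_kClass_eq (φ := φ) (k0.trans k1.symm)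
  have o13 := (hp 1 0 (by omega)).signedMap_mul_of_kClass_eq (φ := φ) (k1.trans k0.symm)
  have o23 := h23.signedMap_mul_of_kClass_eq (φ := φ) (k2.trans k3.symm)
  obtain ⟨a, a1, a2⟩ := h02.exists_conj_signedMap (φ := φ) h k0 k2
  obtain ⟨b, b1, b2⟩ := h02.exists_conj_signedMap (φ := φ) h03 rfl (k2.trans k3.symm)
  obtain ⟨c, c1, c2⟩ := h02.exists_conj_signedMap (φ := φ) h12 (k0.trans k1.symm) rfl
  rw [← a1, ← a2, ← conj_mul, conj_eq_zero_iff]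
  rcases h02.signedMap_cases (φ := φ) with h1 | h1 | h1 | h1
  · exact h1
  · have h2 := congrArg (conj b) h1
    rw [conj_mul, conj_sub, conj_one, conj_zero, b1, b2] at h2
    rw [mul_sub, mul_one, sub_eq_zero] at h1 h2
    refine absurd ?_ (nontrivialIdem_signedMap (φ := φ) h02.left).ne_zero
    rw [h2, h1, mul_assoc, o23, mul_zero]
  · have h2 := congrArg (conj c) h1
    rw [conj_mul, conj_sub, conj_one, conj_zero, c1, c2] at h2
    rw [sub_mul, one_mul, sub_eq_zero] at h1 h2
    refine absurd ?_ (nontrivialIdem_signedMap (φ := φ) h02.right).ne_zero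
    rw [h1, h2, ← mul_assoc, o01, zero_mul]
  · have h2 := congrArg (conj c) h1
    rw [conj_mul, conj_sub, conj_sub, conj_one, conj_zero, c1, c2] at h2
    -- Since `p 2` and `p 3` have orthogonal images, this puts the image of `p 3` under those of
    -- both `p 0` and `p 1`, which are orthogonal.
    have h3 := congrArg (· * signedMap φ (p 3)) h1
    have h4 := congrArg (· * signedMap φ (p 3)) h2
    simp only [mul_assoc, sub_mul (1 : B) (signedMap φ (p 2)), o23, one_mul, sub_zero,
      zero_mul] at h3 h4
    rw [sub_mul, one_mul, sub_eq_zero] at h3 h4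
    refine absurd ?_ (nontrivialIdem_signedMap (φ := φ) h23.right).ne_zero
    rw [h3, h4, ← mul_assoc, o01, zero_mul]

/-- A sum of orthogonal idempotents is their symmetric difference, so the formula holds up to a
complement. The complement is excluded by a third orthogonal idempotent: its nonzero image must be
orthogonal to the image of the sum. -/
theorem StrictlyOrthogonal.signedMap_add {e f : A} (h : StrictlyOrthogonal e f) :
    signedMap φ (e + f) = signedMap φ e + signedMap φ f := by
  obtain ⟨p, hk, hp⟩ := exists_seq fun i => if i = 0 then kClass e else kClass f
  have h01 := hp 0 1 (by omega)
  have h02 := hp 0 2 (by omega)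
  have h12 := hp 1 2 (by omega)
  have h03 := hp 0 3 (by omega)
  have h13 := hp 1 3 (by omega)
  have h23 := hp 2 3 (by omega)
  obtain ⟨g, rfl, rfl⟩ := h01.exists_conj h (hk 0) (hk 1)
  rw [← conj_add, signedMap_conj g h01.idem_add, signedMap_conj g h01.1, signedMap_conj g h01.2,
    ← conj_add]
  congr 1
  -- The fourth idempotent `p 3` guarantees that `p 0 + p 1 + p 2` is not `1`.
  have hso : StrictlyOrthogonal (p 0 + p 1) (p 2) := by
    refine ⟨h01.idem_add, h02.2, by rw [add_mul, h02.3, h12.3, add_zero],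
      by rw [mul_add, h02.4, h12.4, add_zero], h01.add.2, h02.6, fun h0 => h03.6 ?_⟩
    simpa [add_mul, h03.3, h13.3, h23.3] using (congrArg (· * p 3) h0).symm
  have hxor : xor (p 0) (p 1) = p 0 + p 1 := by simp [xor, h01.3]
  have hxor' : xor (signedMap φ (p 0)) (signedMap φ (p 1)) =
      signedMap φ (p 0) + signedMap φ (p 1) := by simp [xor, h01.signedMap_mul]
  have h1 := idemMap_xor φ h01.1 h01.2 h01.commute
  have h2 : signedMap φ (p 0 + p 1) = xor (signedMap φ (p 0)) (signedMap φ (p 1)) ∨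
      signedMap φ (p 0 + p 1) = 1 - xor (signedMap φ (p 0)) (signedMap φ (p 1)) := by
    rw [← hxor]
    rcases signedMap_eq_or (φ := φ) (p 0) with h2 | h2 <;>
      rcases signedMap_eq_or (φ := φ) (p 1) with h3 | h3 <;>
      rcases signedMap_eq_or (φ := φ) (xor (p 0) (p 1)) with h4 | h4 <;>
      simp only [h2, h3, h4, h1, xor_one_sub_left, xor_one_sub_right, sub_sub_cancel, true_or,
        or_true]
  rw [hxor'] at h2
  refine h2.resolve_right fun h3 => (nontrivialIdem_signedMap (φ := φ) h02.right).ne_zero ?_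
  have h4 := hso.signedMap_mul (φ := φ)
  rwa [h3, sub_mul, add_mul, h02.signedMap_mul, h12.signedMap_mul, one_mul, add_zero,
    sub_zero] at h4

/-- The pair `e`, `1 - e` is not strictly orthogonal, so `1 - e` is split into two nonzero pieces,
each strictly orthogonal to `e`. Additivity then makes the images of `e` and `1 - e` orthogonal,
which settles the sign. -/
theorem NontrivialIdem.signedMap_one_sub {e : A} (h : NontrivialIdem e) :
    signedMap φ (1 - e) = 1 - signedMap φ e := by
  obtain ⟨p, hk, hp⟩ := exists_seq fun _ => kClass e
  have h01 := hp 0 1 (by omega)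
  obtain ⟨g, rfl⟩ := h01.left.exists_conj h (hk 0)
  rw [← conj_one g, ← conj_sub, signedMap_conj g h01.left.one_sub.idem, signedMap_conj g h01.1,
    ← conj_one (φ g), ← conj_sub]
  congr 1
  obtain ⟨q, hq⟩ : ∃ q, q = 1 - (p 0 + p 1) := ⟨_, rfl⟩
  have hqi : NontrivialIdem q := hq ▸ h01.add.one_sub
  have h0q : StrictlyOrthogonal (p 0) q := by
    refine ⟨h01.1, hqi.1, ?_, ?_, h01.5, hqi.2, fun h0 => h01.6 ?_⟩
    · simp [hq, mul_sub, mul_add, h01.1.eq, h01.3]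
    · simp [hq, sub_mul, add_mul, h01.1.eq, h01.4]
    · have : p 0 + q = 1 - p 1 := by rw [hq]; abel
      simpa [this] using h0
  have h1q : StrictlyOrthogonal (p 1) q := by
    refine ⟨h01.2, hqi.1, ?_, ?_, h01.6, hqi.2, fun h0 => h01.5 ?_⟩
    · simp [hq, mul_sub, mul_add, h01.2.eq, h01.4]
    · simp [hq, sub_mul, add_mul, h01.2.eq, h01.3]
    · have : p 1 + q = 1 - p 0 := by rw [hq]; abel
      simpa [this] using h0
  have hsum : 1 - p 0 = p 1 + q := by rw [hq]; abel
  have hmul : signedMap φ (p 0) * signedMap φ (1 - p 0) = 0 := by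
    rw [hsum, h1q.signedMap_add, mul_add, h01.signedMap_mul, h0q.signedMap_mul, add_zero]
  have hcases : signedMap φ (1 - p 0) = 1 - signedMap φ (p 0) ∨
      signedMap φ (1 - p 0) = signedMap φ (p 0) := by
    have h1 := idemMap_one_sub φ hA.1 hB.1 h01.1
    rcases signedMap_eq_or (φ := φ) (p 0) with h2 | h2 <;>
      rcases signedMap_eq_or (φ := φ) (1 - p 0) with h3 | h3 <;>
      simp only [h1, h2, h3, sub_sub_cancel, true_or, or_true]
  refine hcases.resolve_right fun h1 => (nontrivialIdem_signedMap (φ := φ) h01.left).ne_zero ?_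
  rwa [h1, (nontrivialIdem_signedMap (φ := φ) h01.left).idem.eq] at hmul

/-! ### The induced isomorphism on `K₀` -/

theorem exists_kHom (φ : Aˣ ≃* Bˣ) : ∃ κ : KZero A →+ KZero B,
    ∀ e : A, NontrivialIdem e → κ (kClass e) = kClass (signedMap φ e) := by
  choose r hr hk using exists_nontrivialIdem (A := A)
  have h (e : A) (he : NontrivialIdem e) :
      kClass (signedMap φ (r (kClass e))) = kClass (signedMap φ e) := by
    -- Independence of the representative: idempotents with the same class are conjugate, and so are
    -- their signed images.
    obtain ⟨g, hg⟩ := (hr (kClass e)).exists_conj he (hk _)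
    conv_rhs => rw [← hg, signedMap_conj g (hr _).1,
      kClass_conj _ (nontrivialIdem_signedMap (φ := φ) (hr _)).1]
  refine ⟨AddMonoidHom.mk' (fun k => kClass (signedMap φ (r k))) fun x y => ?_, h⟩
  obtain ⟨p, hp, ho⟩ := exists_seq fun i => if i = 0 then x else y
  have p0 : kClass (p 0) = x := hp 0
  have p1 : kClass (p 1) = y := hp 1
  have h01 := ho 0 1 (by omega)
  rw [← p0, ← p1, ← kClass_add hA.1 hA.2 h01.1 h01.2 h01.3 h01.4, h _ h01.add, h _ h01.left,
    h _ h01.right, h01.signedMap_add, kClass_add hB.1 hB.2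
      (nontrivialIdem_signedMap (φ := φ) h01.left).1
      (nontrivialIdem_signedMap (φ := φ) h01.right).1 h01.signedMap_mul h01.symm.signedMap_mul]

theorem exists_kEquiv (φ : Aˣ ≃* Bˣ) : ∃ κ : KZero A ≃+ KZero B,
    κ (KZero.unitClass A) = KZero.unitClass B := by
  obtain ⟨κ, hκ⟩ := exists_kHom φ
  have hsub (e : A) (he : NontrivialIdem e) :
      κ (KZero.unitClass A - kClass e) = KZero.unitClass B - κ (kClass e) := by
    rw [← kClass_one_sub hA.1 hA.2 he.1, hκ _ he.one_sub, he.signedMap_one_sub,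
      kClass_one_sub hB.1 hB.2 (nontrivialIdem_signedMap (φ := φ) he).1, hκ e he]
  have hunit : κ (KZero.unitClass A) = KZero.unitClass B := by
    obtain ⟨e, he, -⟩ := exists_nontrivialIdem (0 : KZero A)
    -- The class of the unit is recovered by cancelling `κ (kClass e)` in `hsub`.
    simpa using hsub e he
  have hconj {e f : A} (he : NontrivialIdem e) (hf : NontrivialIdem f) {g : Bˣ}
      (hg : conj g (idemMap φ e) = idemMap φ f) : kClass e = kClass f := by
    rw [← idemMap_symm_idemMap φ he.1, ← kClass_conj (φ.symm g)
      (isIdempotentElem_idemMap φ.symm (isIdempotentElem_idemMap φ he.1)),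
      ← idemMap_conj φ.symm g (isIdempotentElem_idemMap φ he.1), hg, idemMap_symm_idemMap φ hf.1]
  -- Opposite signs cannot give conjugate images: `e` and `1 - f` would have the same class, so `1 -
  -- f` would have positive sign. Compatibility with complements would then make `idemMap φ f` equal
  -- to its own complement.
  have hmixed {e f : A} (he : NontrivialIdem e) (hf : NontrivialIdem f)
      (hse : signedMap φ e = idemMap φ e) (hsf : signedMap φ f = 1 - idemMap φ f)
      (hef : SignPos φ (kClass e)) {g : Bˣ}
      (hg : conj g (signedMap φ e) = signedMap φ f) : False := by
    rw [hse, hsf, ← idemMap_one_sub φ hA.1 hB.1 hf.1] at hg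
    have h1 := hconj he hf.one_sub hg
    have h2 : signedMap φ (1 - f) = idemMap φ (1 - f) := by
      rw [signedMap, ← h1, if_pos hef]
    rw [hf.signedMap_one_sub, hsf, idemMap_one_sub φ hA.1 hB.1 hf.1, sub_sub_cancel] at h2
    have h3 := congrArg (idemMap φ f * ·) h2
    simp only [mul_sub, (nontrivialIdem_idemMap φ hf).1.eq, mul_one, sub_self] at h3
    exact (nontrivialIdem_idemMap φ hf).2 h3
  refine ⟨AddEquiv.ofBijective κ ⟨?_, ?_⟩, hunit⟩
  · intro x y hxy
    obtain ⟨e, he, rfl⟩ := exists_nontrivialIdem x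
    obtain ⟨f, hf, rfl⟩ := exists_nontrivialIdem y
    rw [hκ e he, hκ f hf] at hxy
    obtain ⟨g, hg⟩ := (nontrivialIdem_signedMap (φ := φ) he).exists_conj
      (nontrivialIdem_signedMap (φ := φ) hf) hxy
    have hg' : conj g⁻¹ (signedMap φ f) = signedMap φ e := by rw [← hg, conj_inv_conj]
    by_cases hse : SignPos φ (kClass e) <;> by_cases hsf : SignPos φ (kClass f)
    · rw [signedMap, if_pos hse, signedMap, if_pos hsf] at hg
      exact hconj he hf hg
    · exact (hmixed he hf (if_pos hse) (if_neg hsf) hse hg).elim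
    · exact (hmixed hf he (if_pos hsf) (if_neg hse) hsf hg').elim
    · rw [signedMap, if_neg hse, signedMap, if_neg hsf, conj_sub, conj_one] at hg
      exact hconj he hf (sub_right_injective hg)
  · intro y
    obtain ⟨f, hf, rfl⟩ := exists_nontrivialIdem y
    have he : NontrivialIdem (idemMap φ.symm f) := nontrivialIdem_idemMap φ.symm hf
    rcases signedMap_eq_or (φ := φ) (idemMap φ.symm f) with h | h <;>
      rw [idemMap_idemMap_symm φ hf.1] at h
    · exact ⟨_, by rw [hκ _ he, h]⟩
    -- When the signed image is `1 - f`, the preimage is the class of the complement of `idemMap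
    -- φ.symm f`.
    · exact ⟨_, by rw [hsub _ he, hκ _ he, h, kClass_one_sub hB.1 hB.2 hf.1, sub_sub_cancel]⟩

end KTheory
end CStarK

theorem theorem5p2 {A : Type*} {B : Type*} [CStarAlgebra A] [CStarAlgebra B]
    (hAsimple : CStarK.IsSimple A) (hApi : CStarK.IsPurelyInfinite A)
    (hBsimple : CStarK.IsSimple B) (hBpi : CStarK.IsPurelyInfinite B)
    (hGL : Nonempty (Aˣ ≃* Bˣ)) :
    ∃ f : CStarK.KZero A ≃+ CStarK.KZero B,
      f (CStarK.KZero.unitClass A) = CStarK.KZero.unitClass B := by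
  have : CStarK.IsPISimple A := ⟨hAsimple, hApi⟩
  have : CStarK.IsPISimple B := ⟨hBsimple, hBpi⟩
  obtain ⟨φ⟩ := hGL
  exact CStarK.exists_kEquiv φ
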